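/- Let $f\in C^1([0,1])$ be bistable: $f(0)=f(1)=0$, $f'(0)<0$, $f'(1)<0$, and there is $\alpha\in(0,1)$ with $f<0$ on $(0,\alpha)$ and $f>0$ on $(\alpha,1)$. Let $\Phi_\infty$ be a travelling wave with speed $c^*$, that is, a twice differentiable solution on $\mathbb{R}$ of $$\Phi''+c^*\Phi'+f(\Phi)=0,\qquad 0\le\Phi\le1,\quad \Phi(-\infty)=0,\ \Phi(+\infty)=1,\quad \Phi'>0 .$$ For $a<b$, call $u\in C([a,b])\cap C^2((a,b))$ a stationary solution on $(a,b)$ if $0\le u\le1$, $u(a)=0$, $u(b)=1$ and $$u''+\lambda(u')\,u'+f(u)=0\ \text{ on }(a,b),\qquad \lambda(u')=-\frac{\int_0^1 f(s)\,ds}{\|u'\|_{L^2(a,b)}^2}.$$ Then the following hold as the interval length $r=b-a$ tends to $\infty$. 1. The speed $\lambda_r=\lambda(u')$ of the stationary solution converges to $c^*$: for every $\varepsilon>0$ there is $R$ such that $|\lambda(u')-c^*|<\varepsilon$ for every stationary solution $u$ on any interval $(a,b)$ with $b-a>R$. 2. Suppose that $\Phi_\infty(0)=1/2$. Let $\Phi_r$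 be the stationary solution normalized by translation so that $a<0<b$ and $\Phi_r(0)=1/2$, and extended to $\mathbb{R}$ by $0$ to the left of $a$ and by $1$ to the right of $b$. Then $$\|\Phi_r-\Phi_\infty\|_{W^{1,\infty}(\mathbb{R})}+\|\Phi_r'-\Phi_\infty'\|_{L^2(\mathbb{R})}\to0,$$ that is, for every $\varepsilon>0$ there is $R$ such that the left side is less than $\varepsilon$ for every such normalized stationary solution with $b-a>R$. Here $\|g\|_{W^{1,\infty}}=\|g\|_{L^\infty}+\|g'\|_{L^\infty}$, and derivatives on $\mathbb{R}$ are weak derivatives. -/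

import Mathlib

open MeasureTheory Set Filter Topology
open scoped ENNReal ContDiff

noncomputable section

/-- A bistable nonlinearity of class `C¹` on `[0,1]`. Only the values of `f` on `[0,1]` matter;
the derivatives at `0` and `1` are one-sided. -/
structure IsBistable (f : ℝ → ℝ) : Prop where
  contDiffOn : ContDiffOn ℝ 1 f (Icc 0 1)
  map_zero : f 0 = 0
  map_one : f 1 = 0
  deriv_zero_neg : derivWithin f (Icc 0 1) 0 < 0
  deriv_one_neg : derivWithin f (Icc 0 1) 1 < 0
  exists_threshold : ∃ α ∈ Ioo (0 : ℝ) 1,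
    (∀ u ∈ Ioo 0 α, f u < 0) ∧ (∀ u ∈ Ioo α 1, 0 < f u)

/-- `Φ` is a (monotone, classical) `[0,1]`-wave front with speed `c`:
`Φ'' + c Φ' + f(Φ) = 0` on `ℝ`, `0 ≤ Φ ≤ 1`, `Φ(-∞) = 0`, `Φ(+∞) = 1`, `Φ' > 0`. -/
structure IsTravellingWave (f : ℝ → ℝ) (c : ℝ) (Φ : ℝ → ℝ) : Prop where
  differentiable : Differentiable ℝ Φ
  differentiable_deriv : Differentiable ℝ (deriv Φ)
  ode : ∀ x, deriv (deriv Φ) x + c * deriv Φ x + f (Φ x) = 0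
  mem_Icc : ∀ x, Φ x ∈ Icc (0 : ℝ) 1
  tendsto_atBot : Tendsto Φ atBot (𝓝 0)
  tendsto_atTop : Tendsto Φ atTop (𝓝 1)
  deriv_pos : ∀ x, 0 < deriv Φ x

/-- The nonlocal speed `λ(u') = -(∫₀¹ f) / ‖u'‖²` with the norm of `L²(a,b)`. For `u(a) = 0` and
`u(b) = 1` this is `-⟨f(u), u'⟩ / ⟨u', u'⟩`. -/
def nonlocalSpeed (f : ℝ → ℝ) (a b : ℝ) (u : ℝ → ℝ) : ℝ :=
  -(∫ s in (0 : ℝ)..1, f s) / ∫ x in a..b, (deriv u x) ^ 2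

/-- `u` is a classical stationary solution, with values in `[0,1]`, of the nonlocal problem
`u_t = u_xx + λ(u_x) u_x + f(u)` on `(a,b)`, `u(a) = 0`, `u(b) = 1`.
Nothing is required of `u` outside `[a,b]`. Since `u''+ λ u'` is bounded, `u'` is bounded
on `(a,b)`, so that the integral in `nonlocalSpeed` is finite. -/
structure IsStationarySolution (f : ℝ → ℝ) (a b : ℝ) (u : ℝ → ℝ) : Prop where
  lt : a < b
  continuousOn : ContinuousOn u (Icc a b)
  differentiableAt : ∀ x ∈ Ioo a b, DifferentiableAt ℝ u x
  differentiableAt_deriv : ∀ x ∈ Ioo a b, DifferentiableAt ℝ (deriv u) x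
  ode : ∀ x ∈ Ioo a b,
    deriv (deriv u) x + nonlocalSpeed f a b u * deriv u x + f (u x) = 0
  left : u a = 0
  right : u b = 1
  mem_Icc : ∀ x ∈ Icc a b, u x ∈ Icc (0 : ℝ) 1

/-- The extension of `u : [a,b] → ℝ` by `0` to the left of `a` and by `1` to the right of `b`. -/
def extendZeroOne (a b : ℝ) (u : ℝ → ℝ) (x : ℝ) : ℝ :=
  if x < a then 0 else if x ≤ b then u x else 1

/-- `g'` is a weak (distributional) derivative of `g` on `ℝ`. -/
structure HasWeakDeriv (g g' : ℝ → ℝ) : Prop where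
  locallyIntegrable : LocallyIntegrable g volume
  locallyIntegrable_deriv : LocallyIntegrable g' volume
  integral_eq : ∀ φ : ℝ → ℝ, ContDiff ℝ ∞ φ → HasCompactSupport φ →
    ∫ x, g x * deriv φ x = -∫ x, g' x * φ x

/-- The norm of `W^{1,∞}(ℝ)`, namely `‖g‖_∞ + ‖g'‖_∞` with the weak derivative `g'`.
The weak derivative is unique up to null sets, so the infimum is over at most one value;
it is `∞` if `g` has no weak derivative. -/
def sobolevNormInfty (g : ℝ → ℝ) : ℝ≥0∞ :=
  ⨅ (g' : ℝ → ℝ) (_ : HasWeakDeriv g g'), eLpNorm g ∞ volume + eLpNorm g' ∞ volume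

/-- `‖g'‖_{L²(ℝ)}` for the weak derivative `g'` of `g`, and `∞` if there is none. -/
def weakDerivNormTwo (g : ℝ → ℝ) : ℝ≥0∞ :=
  ⨅ (g' : ℝ → ℝ) (_ : HasWeakDeriv g g'), eLpNorm g' 2 volume

end

/-! Everything is compared in the phase plane, with slopes read as functions of the height: let `Q
s` be the slope of the front at height `s`, and `v = u'` for a stationary solution of speed `lam` on
`(a,b)`.

Multiplying the equation by `u'` and integrating shows that the nonlocal choice of `lam` says
exactly that the slopes at both ends agree; call them `p`. The excess `w = v - Q(u)` therefore
equals `p` at both ends, and it satisfies `w' = (c - lam) v + (g(u)/Q(u)) w`. At a zero of `w` the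
derivative has the sign of `c - lam`, so a comparison started at the appropriate end gives `w > 0`
(`IsProfile.slope_lt`); in particular `u` is increasing. Since `g` changes sign only at `α`, `w - (c
- lam) u` decreases below height `α` and increases above it. Reading this from both ends bounds `|c
- lam|` and `w` by multiples of `p` (`IsProfile.abs_speed_sub_le`).

It remains to see that `p → 0` (`IsFront.exists_length_slope_lt`). A slope `p ≥ δ` persists near the
ends, because `lam` is bounded a priori, and in the middle `v ≥ Q(u)` is bounded below; so `u`
climbs from `0` to `1` in bounded length. This settles the speed.

For the profiles, the shift `Ψ(u(x)) - x` relative to the front has derivative `w / Q(u)`, hence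
stays small between heights `ε` and `1 - ε`; outside, both functions are near the same constant and
both slopes are small (`IsFront.exists_length_uniform_close`). The `L²` bound follows by
interpolating the uniform bound with the `L¹` norms of the two slopes, which are both `1`. -/

/-- A globally Lipschitz bistable nonlinearity with threshold `α`. -/
structure BistableLipschitz (g : ℝ → ℝ) (K : NNReal) (α : ℝ) : Prop where
  lipschitz : LipschitzWith K g
  map_zero : g 0 = 0
  map_one : g 1 = 0
  mem_Ioo : α ∈ Ioo (0 : ℝ) 1
  neg : ∀ s ∈ Ioo 0 α, g s < 0
  pos : ∀ s ∈ Ioo α 1, 0 < g s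

theorem BistableLipschitz.nonpos {g : ℝ → ℝ} {K : NNReal} {α : ℝ} (h : BistableLipschitz g K α)
    {s : ℝ} (hs : s ∈ Ico 0 α) : g s ≤ 0 := by
  rcases eq_or_lt_of_le hs.1 with h0 | h0
  · rw [← h0, h.map_zero]
  · exact (h.neg s ⟨h0, hs.2⟩).le

theorem BistableLipschitz.nonneg {g : ℝ → ℝ} {K : NNReal} {α : ℝ} (h : BistableLipschitz g K α)
    {s : ℝ} (hs : s ∈ Ioc α 1) : 0 ≤ g s := by
  rcases eq_or_lt_of_le hs.2 with h0 | h0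
  · rw [h0, h.map_one]
  · exact (h.pos s ⟨hs.1, h0⟩).le

/-! ### Phase plane curves: one-sided derivatives, reflection, uniqueness. -/

/-- `(u, v)` solves the phase plane system `u' = v`, `v' = -λ v - g(u)` on `(a,b)`, continuously
up to the end points. -/
structure IsPhaseCurve (g : ℝ → ℝ) (lam a b : ℝ) (u v : ℝ → ℝ) : Prop where
  continuousOn_fst : ContinuousOn u (Icc a b)
  continuousOn_snd : ContinuousOn v (Icc a b)
  hasDerivAt_fst : ∀ x ∈ Ioo a b, HasDerivAt u (v x) x
  hasDerivAt_snd : ∀ x ∈ Ioo a b, HasDerivAt v (-lam * v x - g (u x)) x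

/-- A derivative with a limit at the end point gives the one-sided derivative there; ODE uniqueness
can thus start at the boundary. -/
theorem hasDerivWithinAt_Ici_left {a b : ℝ} (hab : a < b) {w w' : ℝ → ℝ}
    (hw : ContinuousOn w (Icc a b)) (hw' : ContinuousOn w' (Icc a b))
    (h : ∀ x ∈ Ioo a b, HasDerivAt w (w' x) x) : HasDerivWithinAt w (w' a) (Ici a) a := by
  refine hasDerivWithinAt_Ici_of_tendsto_deriv (s := Ioo a b)
    (fun x hx => (h x hx).differentiableAt.differentiableWithinAt)
    ((hw a ⟨le_rfl, hab.le⟩).mono Ioo_subset_Icc_self) (Ioo_mem_nhdsGT hab) ?_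
  have h1 : Tendsto w' (𝓝[>] a) (𝓝 (w' a)) := by
    have := (hw' a ⟨le_rfl, hab.le⟩).mono Ioo_subset_Icc_self
    rwa [ContinuousWithinAt, nhdsWithin_Ioo_eq_nhdsGT hab] at this
  refine h1.congr' ?_
  filter_upwards [Ioo_mem_nhdsGT hab] with x hx
  exact (h x hx).deriv.symm

namespace IsPhaseCurve

variable {g : ℝ → ℝ} {K : NNReal} {lam a b : ℝ} {u v u₂ v₂ : ℝ → ℝ}

theorem hasDerivWithinAt (h : IsPhaseCurve g lam a b u v) (hg : Continuous g) :
    ∀ t ∈ Ico a b, HasDerivWithinAt u (v t) (Ici t) t ∧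
      HasDerivWithinAt v (-lam * v t - g (u t)) (Ici t) t := by
  intro t ht
  have hs : Icc t b ⊆ Icc a b := Icc_subset_Icc_left ht.1
  have hs' : Ioo t b ⊆ Ioo a b := Ioo_subset_Ioo_left ht.1
  refine ⟨hasDerivWithinAt_Ici_left ht.2 (h.continuousOn_fst.mono hs)
    (h.continuousOn_snd.mono hs) fun x hx => h.hasDerivAt_fst x (hs' hx),
    hasDerivWithinAt_Ici_left (w' := fun x => -lam * v x - g (u x)) ht.2
      (h.continuousOn_snd.mono hs) ?_ fun x hx => h.hasDerivAt_snd x (hs' hx)⟩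
  exact ((continuousOn_const.mul h.continuousOn_snd).sub
    (hg.comp_continuousOn h.continuousOn_fst)).mono hs

theorem mono (h : IsPhaseCurve g lam a b u v) {a' b' : ℝ} (ha : a ≤ a') (hb : b' ≤ b) :
    IsPhaseCurve g lam a' b' u v where
  continuousOn_fst := h.continuousOn_fst.mono (Icc_subset_Icc ha hb)
  continuousOn_snd := h.continuousOn_snd.mono (Icc_subset_Icc ha hb)
  hasDerivAt_fst x hx := h.hasDerivAt_fst x (Ioo_subset_Ioo ha hb hx)
  hasDerivAt_snd x hx := h.hasDerivAt_snd x (Ioo_subset_Ioo ha hb hx)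

/-- Reversing `x` only flips the sign of the speed, so arguments that run forward from the left end
also run backward from the right end. -/
theorem reflect (h : IsPhaseCurve g lam a b u v) :
    IsPhaseCurve g (-lam) (-b) (-a) (fun x => u (-x)) (fun x => -v (-x)) where
  continuousOn_fst := h.continuousOn_fst.comp continuousOn_neg fun x hx =>
    ⟨by linarith [hx.2], by linarith [hx.1]⟩
  continuousOn_snd := (h.continuousOn_snd.comp continuousOn_neg fun x hx =>
    ⟨by linarith [hx.2], by linarith [hx.1]⟩).neg
  hasDerivAt_fst x hx := by
    have := (h.hasDerivAt_fst (-x) ⟨by linarith [hx.2], by linarith [hx.1]⟩).comp x (hasDerivAt_neg x)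
    simpa [Function.comp_def] using this
  hasDerivAt_snd x hx := by
    have := ((h.hasDerivAt_snd (-x) ⟨by linarith [hx.2], by linarith [hx.1]⟩).comp x
      (hasDerivAt_neg x)).fun_neg
    exact this.congr_deriv (by ring)

theorem unique (h : IsPhaseCurve g lam a b u v) (h₂ : IsPhaseCurve g lam a b u₂ v₂)
    (hg : LipschitzWith K g) (hu : u a = u₂ a) (hv : v a = v₂ a) : EqOn u u₂ (Icc a b) := by
  have hl : ∃ C, LipschitzWith C (fun q : ℝ × ℝ => (q.2, -lam * q.2 - g q.1)) :=
    ⟨_, LipschitzWith.prodMk LipschitzWith.prod_snd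
      (((lipschitzWith_smul (-lam)).comp LipschitzWith.prod_snd).sub
        (hg.comp LipschitzWith.prod_fst))⟩
  obtain ⟨C, hC⟩ := hl
  have key := ODE_solution_unique_of_mem_Icc_right
    (v := fun _ (q : ℝ × ℝ) => (q.2, -lam * q.2 - g q.1)) (s := fun _ => univ) (K := C)
    (f := fun t => (u t, v t)) (g := fun t => (u₂ t, v₂ t)) (a := a) (b := b)
    (fun t _ => hC.lipschitzOnWith) (h.continuousOn_fst.prodMk h.continuousOn_snd)
    (fun t ht => (h.hasDerivWithinAt hg.continuous t ht).1.prodMk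
      (h.hasDerivWithinAt hg.continuous t ht).2) (fun _ _ => mem_univ _)
    (h₂.continuousOn_fst.prodMk h₂.continuousOn_snd)
    (fun t ht => (h₂.hasDerivWithinAt hg.continuous t ht).1.prodMk
      (h₂.hasDerivWithinAt hg.continuous t ht).2) (fun _ _ => mem_univ _) (by simp [hu, hv])
  intro t ht
  exact congrArg Prod.fst (key ht)

theorem const {s : ℝ} (hs : g s = 0) : IsPhaseCurve g lam a b (fun _ => s) (fun _ => 0) where
  continuousOn_fst := continuousOn_const
  continuousOn_snd := continuousOn_const
  hasDerivAt_fst x _ := hasDerivAt_const x s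
  hasDerivAt_snd x _ := by simpa [hs] using hasDerivAt_const x (0 : ℝ)

end IsPhaseCurve

/-! ### Stationary solutions as profiles with equal end slopes. -/

/-- A stationary profile of speed `lam` connecting `0` to `1` on `[a,b]`, with equal slopes `p` at
both ends. -/
structure IsProfile (g : ℝ → ℝ) (lam a b p : ℝ) (u v : ℝ → ℝ) : Prop extends
    IsPhaseCurve g lam a b u v where
  lt : a < b
  left : u a = 0
  right : u b = 1
  mem_Ioo : ∀ x ∈ Ioo a b, u x ∈ Ioo (0 : ℝ) 1
  slope_left : v a = p
  slope_right : v b = p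
  slope_pos : 0 < p
  speed : lam * ∫ x in a..b, v x ^ 2 = -∫ s in (0 : ℝ)..1, g s

/-- At an interior contact with `0` or `1` the slope vanishes, so uniqueness makes `u` constant up
to the end where it takes the other value. -/
theorem IsPhaseCurve.mem_Ioo_of_mem_Icc {g : ℝ → ℝ} {K : NNReal} {α lam a b : ℝ} {u v : ℝ → ℝ}
    (h : IsPhaseCurve g lam a b u v) (hg : BistableLipschitz g K α)
    (ha : u a = 0) (hb : u b = 1) (hI : ∀ x ∈ Icc a b, u x ∈ Icc (0 : ℝ) 1) :
    ∀ x ∈ Ioo a b, u x ∈ Ioo (0 : ℝ) 1 := by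
  intro x hx
  have hnhds : Icc a b ∈ 𝓝 x := Icc_mem_nhds hx.1 hx.2
  have hIx := hI x (Ioo_subset_Icc_self hx)
  refine ⟨lt_of_le_of_ne hIx.1 fun h0 => ?_, lt_of_le_of_ne hIx.2 fun h1 => ?_⟩
  · have hmin : IsLocalMin u x := by
      filter_upwards [hnhds] with y hy
      rw [← h0]; exact (hI y hy).1
    have hv : v x = 0 := hmin.hasDerivAt_eq_zero (h.hasDerivAt_fst x hx)
    have := (h.mono hx.1.le le_rfl).unique (IsPhaseCurve.const hg.map_zero) hg.lipschitz h0.symm hv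
      (right_mem_Icc.2 hx.2.le)
    simp [hb] at this
  · have hmax : IsLocalMax u x := by
      filter_upwards [hnhds] with y hy
      rw [h1]; exact (hI y hy).2
    have hv : v x = 0 := hmax.hasDerivAt_eq_zero (h.hasDerivAt_fst x hx)
    have := (h.mono le_rfl hx.2.le).reflect.unique (IsPhaseCurve.const hg.map_one) hg.lipschitz
      (by simpa using h1) (by simpa using hv) (right_mem_Icc.2 (by linarith [hx.1]))
    simp [ha] at this

theorem nonneg_of_hasDerivWithinAt_Ici {w : ℝ → ℝ} {a b d : ℝ} (hab : a < b)
    (hw : HasDerivWithinAt w d (Ici a) a) (h : ∀ x ∈ Icc a b, w a ≤ w x) : 0 ≤ d := by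
  have h1 := (hasDerivWithinAt_iff_tendsto_slope' (by simp)).1 (hw.mono Ioi_subset_Ici_self)
  refine ge_of_tendsto h1 ?_
  filter_upwards [Ioo_mem_nhdsGT hab] with x hx
  rw [slope_def_field]
  exact div_nonneg (by linarith [h x (Ioo_subset_Icc_self hx)]) (by linarith [hx.1])

theorem IsPhaseCurve.slope_nonneg {g : ℝ → ℝ} {lam a b : ℝ} {u v : ℝ → ℝ}
    (h : IsPhaseCurve g lam a b u v) (hg : Continuous g) (hab : a < b)
    (hI : ∀ x ∈ Icc a b, u a ≤ u x) : 0 ≤ v a :=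
  nonneg_of_hasDerivWithinAt_Ici hab (h.hasDerivWithinAt hg a ⟨le_rfl, hab⟩).1 hI

/-- Multiply the equation for `v` by `v = u'` and integrate; the reaction term becomes an integral
over heights by substitution. -/
theorem IsPhaseCurve.energy {g : ℝ → ℝ} {lam a b : ℝ} {u v : ℝ → ℝ}
    (h : IsPhaseCurve g lam a b u v) (hg : Continuous g) (hab : a ≤ b) :
    v b ^ 2 / 2 - v a ^ 2 / 2 + lam * ∫ x in a..b, v x ^ 2 = -∫ s in (u a)..(u b), g s := by
  have hu := h.continuousOn_fst
  have hv := h.continuousOn_snd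
  have h1 : ∫ x in a..b, (g ∘ u) x * v x = ∫ s in (u a)..(u b), g s := by
    refine intervalIntegral.integral_comp_mul_deriv'' (by rwa [uIcc_of_le hab]) ?_
      (by rwa [uIcc_of_le hab]) hg.continuousOn
    intro x hx
    rw [min_eq_left hab, max_eq_right hab] at hx
    exact (h.hasDerivAt_fst x hx).hasDerivWithinAt
  have h2 : ∫ x in a..b, v x * (-lam * v x - g (u x)) = v b ^ 2 / 2 - v a ^ 2 / 2 := by
    refine intervalIntegral.integral_eq_sub_of_hasDerivAt_of_le (f := fun x => v x ^ 2 / 2) hab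
      ((hv.pow 2).div_const 2) (fun x hx => ?_) ?_
    · exact (((h.hasDerivAt_snd x hx).fun_pow 2).div_const 2).congr_deriv (by push_cast; ring)
    · refine ContinuousOn.intervalIntegrable_of_Icc hab ?_
      exact hv.mul ((continuousOn_const.mul hv).sub (hg.comp_continuousOn hu))
  have e : ∀ x, v x * (-lam * v x - g (u x)) = -lam * v x ^ 2 - (g ∘ u) x * v x := by
    intro x; simp only [Function.comp]; ring
  simp_rw [e] at h2
  rw [intervalIntegral.integral_sub, intervalIntegral.integral_const_mul, h1] at h2
  · linarith
  · exact (continuousOn_const.mul (hv.pow 2)).intervalIntegrable_of_Icc hab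
  · exact ((hg.comp_continuousOn hu).mul hv).intervalIntegrable_of_Icc hab

/-- The speed relation cancels against the energy identity and leaves `v a ^ 2 = v b ^ 2`. Both
slopes are nonnegative as `0 ≤ u ≤ 1`, and `v a = 0` would force `u = 0` by uniqueness. -/
theorem IsPhaseCurve.isProfile {g : ℝ → ℝ} {K : NNReal} {α lam a b : ℝ} {u v : ℝ → ℝ}
    (h : IsPhaseCurve g lam a b u v) (hg : BistableLipschitz g K α) (hab : a < b)
    (ha : u a = 0) (hb : u b = 1) (hI : ∀ x ∈ Icc a b, u x ∈ Icc (0 : ℝ) 1)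
    (hs : lam * ∫ x in a..b, v x ^ 2 = -∫ s in (0 : ℝ)..1, g s) :
    IsProfile g lam a b (v a) u v := by
  have hgc := hg.lipschitz.continuous
  have hva : 0 ≤ v a := h.slope_nonneg hgc hab fun x hx => by rw [ha]; exact (hI x hx).1
  have hva' : v a ≠ 0 := fun h0 => by
    have := h.unique (IsPhaseCurve.const hg.map_zero) hg.lipschitz ha h0 (right_mem_Icc.2 hab.le)
    simp [hb] at this
  have hvb : 0 ≤ v b := by
    have hneg : HasDerivWithinAt (fun x => -u (-x)) (v b) (Ici (-b)) (-b) := by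
      simpa using (h.reflect.hasDerivWithinAt hgc (-b) ⟨le_rfl, by linarith⟩).1.fun_neg
    refine nonneg_of_hasDerivWithinAt_Ici (b := -a) (by linarith) hneg fun x hx => ?_
    simp only [neg_neg, hb]
    linarith [(hI (-x) ⟨by linarith [hx.2], by linarith [hx.1]⟩).2]
  have he := h.energy hgc hab.le
  rw [hs, ha, hb] at he
  exact { h with
    lt := hab
    left := ha
    right := hb
    mem_Ioo := h.mem_Ioo_of_mem_Icc hg ha hb hI
    slope_left := rfl
    slope_right := by
      rw [← abs_of_nonneg hva, ← abs_of_nonneg hvb, ← sq_eq_sq_iff_abs_eq_abs]; linarith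
    slope_pos := lt_of_le_of_ne hva hva'.symm
    speed := hs }

/-- Nothing is known of `f` off `[0,1]`; a Lipschitz extension makes the phase plane system globally
Lipschitz. -/
theorem IsBistable.exists_lipschitz {f : ℝ → ℝ} (hf : IsBistable f) :
    ∃ g K α, BistableLipschitz g K α ∧ EqOn f g (Icc 0 1) := by
  obtain ⟨K, hK⟩ := hf.contDiffOn.exists_lipschitzOnWith one_ne_zero (convex_Icc 0 1) isCompact_Icc
  obtain ⟨g, hg, he⟩ := hK.extend_real
  obtain ⟨α, hα, hn, hp⟩ := hf.exists_threshold
  refine ⟨g, K, α, ⟨hg, ?_, ?_, hα, fun s hs => ?_, fun s hs => ?_⟩, he⟩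
  · rw [← he (by simp), hf.map_zero]
  · rw [← he (by simp), hf.map_one]
  · rw [← he ⟨hs.1.le, (hs.2.trans hα.2).le⟩]; exact hn s hs
  · rw [← he ⟨(hα.1.trans hs.1).le, hs.2.le⟩]; exact hp s hs

theorem IsStationarySolution.exists_isProfile {f g : ℝ → ℝ} {K : NNReal} {α a b : ℝ} {u : ℝ → ℝ}
    (hu : IsStationarySolution f a b u) (hg : BistableLipschitz g K α) (he : EqOn f g (Icc 0 1)) :
    ∃ p v, IsProfile g (nonlocalSpeed f a b u) a b p u v := by
  set lam := nonlocalSpeed f a b u with hlam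
  have hab := hu.lt
  have hgc := hg.lipschitz.continuous
  obtain ⟨M, hM⟩ := (isCompact_Icc (a := (0 : ℝ)) (b := 1)).exists_bound_of_continuousOn
    hgc.continuousOn
  -- The derivative `-g(u)` is bounded, so `u' + lam u` is Lipschitz. Its extension `W` provides the
  -- slope `W - lam u` up to the end points, where `deriv u` itself is uncontrolled.
  have hd : ∀ x ∈ Ioo a b, HasDerivAt (fun y => deriv u y + lam * u y) (-g (u x)) x := by
    intro x hx
    have h1 := (hu.differentiableAt_deriv x hx).hasDerivAt.fun_add
      ((hu.differentiableAt x hx).hasDerivAt.const_mul lam)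
    have h2 := hu.ode x hx
    rw [← hlam, he (hu.mem_Icc x (Ioo_subset_Icc_self hx))] at h2
    exact h1.congr_deriv (by linarith)
  have hl : LipschitzOnWith M.toNNReal (fun y => deriv u y + lam * u y) (Ioo a b) := by
    refine (convex_Ioo a b).lipschitzOnWith_of_nnnorm_hasDerivWithin_le
      (fun x hx => (hd x hx).hasDerivWithinAt) fun x hx => ?_
    rw [nnnorm_neg, ← NNReal.coe_le_coe, coe_nnnorm]
    exact (hM _ (hu.mem_Icc x (Ioo_subset_Icc_self hx))).trans (Real.le_coe_toNNReal M)
  obtain ⟨W, hW, hWe⟩ := hl.extend_real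
  have hve : ∀ x ∈ Ioo a b, deriv u x = W x - lam * u x := fun x hx => by
    have := hWe hx
    simp only at this
    linarith
  have hc : IsPhaseCurve g lam a b u (fun x => W x - lam * u x) := by
    refine ⟨hu.continuousOn, hW.continuous.continuousOn.sub (continuousOn_const.mul hu.continuousOn),
      fun x hx => ?_, fun x hx => ?_⟩
    · rw [← hve x hx]; exact (hu.differentiableAt x hx).hasDerivAt
    · have h1 := (hu.differentiableAt_deriv x hx).hasDerivAt
      have h2 := hu.ode x hx
      rw [← hlam, he (hu.mem_Icc x (Ioo_subset_Icc_self hx))] at h2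
      have h3 : deriv (deriv u) x = -lam * (W x - lam * u x) - g (u x) := by
        rw [← hve x hx]; linarith
      rw [← h3]
      refine h1.congr_of_eventuallyEq ?_
      filter_upwards [Ioo_mem_nhds hx.1 hx.2] with y hy
      exact (hve y hy).symm
  refine ⟨_, _, hc.isProfile hg hab hu.left hu.right hu.mem_Icc ?_⟩
  have hI : ∫ x in a..b, deriv u x ^ 2 = ∫ x in a..b, (W x - lam * u x) ^ 2 := by
    rw [intervalIntegral.integral_of_le hab.le, intervalIntegral.integral_of_le hab.le,
      integral_Ioc_eq_integral_Ioo, integral_Ioc_eq_integral_Ioo]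
    exact setIntegral_congr_fun measurableSet_Ioo fun x hx => by simp only [hve x hx]
  have hf : ∫ s in (0 : ℝ)..1, f s = ∫ s in (0 : ℝ)..1, g s :=
    intervalIntegral.integral_congr fun s hs => he (by rwa [uIcc_of_le zero_le_one] at hs)
  -- The quotient defining the speed must have a nonzero denominator; the mean value theorem
  -- supplies a point of slope `1 / (b - a)`.
  have hpos : 0 < ∫ x in a..b, (W x - lam * u x) ^ 2 := by
    refine intervalIntegral.integral_pos hab (hc.continuousOn_snd.pow 2) (fun _ _ => sq_nonneg _) ?_
    obtain ⟨x, hx, hx'⟩ := exists_hasDerivAt_eq_slope u _ hab hu.continuousOn hc.hasDerivAt_fst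
    refine ⟨x, Ioo_subset_Icc_self hx, ?_⟩
    rw [hx', hu.left, hu.right]
    have : 0 < b - a := by linarith
    positivity
  rw [← hI] at hpos ⊢
  rw [hlam, nonlocalSpeed, hf, div_mul_cancel₀ _ hpos.ne']

/-! ### The front in the phase plane. -/

/-- The phase plane data of a wave front `Φ` of speed `c`: its inverse `Ψ` and its slope `Q`, as a
function of the height. -/
structure IsFront (g : ℝ → ℝ) (c : ℝ) (Φ Ψ Q : ℝ → ℝ) : Prop where
  strictMono : StrictMono Φ
  mem_Ioo : ∀ x, Φ x ∈ Ioo (0 : ℝ) 1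
  tendsto_atBot : Tendsto Φ atBot (𝓝 0)
  tendsto_atTop : Tendsto Φ atTop (𝓝 1)
  hasDerivAt : ∀ x, HasDerivAt Φ (Q (Φ x)) x
  left_inv : ∀ x, Ψ (Φ x) = x
  right_inv : ∀ s ∈ Ioo (0 : ℝ) 1, Φ (Ψ s) = s
  hasDerivAt_inv : ∀ s ∈ Ioo (0 : ℝ) 1, HasDerivAt Ψ (Q s)⁻¹ s
  continuousOn_slope : ContinuousOn Q (Icc 0 1)
  slope_zero : Q 0 = 0
  slope_one : Q 1 = 0
  slope_pos : ∀ s ∈ Ioo (0 : ℝ) 1, 0 < Q s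
  hasDerivAt_slope : ∀ s ∈ Ioo (0 : ℝ) 1, HasDerivAt Q (-c - g s / Q s) s

namespace IsTravellingWave

variable {f g : ℝ → ℝ} {K : NNReal} {α c : ℝ} {Φ : ℝ → ℝ}

theorem strictMono (h : IsTravellingWave f c Φ) : StrictMono Φ :=
  strictMono_of_deriv_pos h.deriv_pos

theorem mem_Ioo (h : IsTravellingWave f c Φ) (x : ℝ) : Φ x ∈ Ioo (0 : ℝ) 1 :=
  ⟨(h.mem_Icc (x - 1)).1.trans_lt (h.strictMono (by linarith)),
    (h.strictMono (by linarith)).trans_le (h.mem_Icc (x + 1)).2⟩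

theorem hasDerivAt_deriv (h : IsTravellingWave f c Φ) (he : EqOn f g (Icc 0 1)) (x : ℝ) :
    HasDerivAt (deriv Φ) (-c * deriv Φ x - g (Φ x)) x := by
  refine (h.differentiable_deriv x).hasDerivAt.congr_deriv ?_
  have := h.ode x
  rw [he (h.mem_Icc x)] at this
  linarith

theorem hasDerivAt_add (h : IsTravellingWave f c Φ) (he : EqOn f g (Icc 0 1)) (x : ℝ) :
    HasDerivAt (fun y => deriv Φ y + c * Φ y) (-g (Φ x)) x :=
  ((h.hasDerivAt_deriv he x).fun_add ((h.differentiable x).hasDerivAt.const_mul c)).congr_deriv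
    (by ring)

/-- Where `Φ < α`, `Φ' + c Φ` is nondecreasing. Comparing `x` with a mean value point of `[x, x +
1]` bounds `Φ' x` by a multiple of the increment of `Φ`, which tends to `0`. -/
theorem tendsto_deriv_atBot (h : IsTravellingWave f c Φ) (hg : BistableLipschitz g K α)
    (he : EqOn f g (Icc 0 1)) : Tendsto (deriv Φ) atBot (𝓝 0) := by
  have hlim : Tendsto (fun x => (1 + |c|) * (Φ (x + 1) - Φ x)) atBot (𝓝 0) := by
    have := ((h.tendsto_atBot.comp (tendsto_atBot_add_const_right _ 1 tendsto_id)).sub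
      h.tendsto_atBot).const_mul (1 + |c|)
    simpa using this
  refine tendsto_of_tendsto_of_tendsto_of_le_of_le' tendsto_const_nhds hlim
    (Eventually.of_forall fun x => (h.deriv_pos x).le) ?_
  obtain ⟨x₀, hx₀⟩ := (h.tendsto_atBot.eventually (gt_mem_nhds hg.mem_Ioo.1)).exists
  filter_upwards [eventually_le_atBot (x₀ - 1)] with x hx
  obtain ⟨y, hy, hy'⟩ := exists_hasDerivAt_eq_slope Φ (deriv Φ) (show x < x + 1 by linarith)
    h.differentiable.continuous.continuousOn fun z _ => (h.differentiable z).hasDerivAt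
  have hm : MonotoneOn (fun y => deriv Φ y + c * Φ y) (Icc x (x + 1)) := by
    refine monotoneOn_of_deriv_nonneg (convex_Icc _ _)
      (fun z _ => (h.hasDerivAt_add he z).continuousAt.continuousWithinAt)
      (fun z _ => (h.hasDerivAt_add he z).differentiableAt.differentiableWithinAt) fun z hz => ?_
    rw [interior_Icc] at hz
    rw [(h.hasDerivAt_add he z).deriv]
    have := hg.nonpos ⟨(h.mem_Icc z).1, (h.strictMono (show z < x₀ by linarith [hz.2])).trans hx₀⟩
    linarith
  have h1 := hm (left_mem_Icc.2 (by linarith)) (Ioo_subset_Icc_self hy) hy.1.le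
  simp only at h1
  rw [hy'] at h1
  have h2 : c * (Φ y - Φ x) ≤ |c| * (Φ (x + 1) - Φ x) := by
    have h3 := h.strictMono hy.1
    have h4 := h.strictMono hy.2
    calc _ ≤ |c| * (Φ y - Φ x) := mul_le_mul_of_nonneg_right (le_abs_self c) (by linarith)
      _ ≤ _ := mul_le_mul_of_nonneg_left (by linarith) (abs_nonneg c)
  have h5 : (Φ (x + 1) - Φ x) / (x + 1 - x) = Φ (x + 1) - Φ x := by
    rw [add_sub_cancel_left, div_one]
  rw [h5] at h1
  linarith

theorem tendsto_deriv_atTop (h : IsTravellingWave f c Φ) (hg : BistableLipschitz g K α)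
    (he : EqOn f g (Icc 0 1)) : Tendsto (deriv Φ) atTop (𝓝 0) := by
  have hlim : Tendsto (fun x => (1 + |c|) * (Φ x - Φ (x - 1))) atTop (𝓝 0) := by
    have := (h.tendsto_atTop.sub (h.tendsto_atTop.comp
      (tendsto_atTop_add_const_right _ (-1) tendsto_id))).const_mul (1 + |c|)
    simpa [sub_eq_add_neg] using this
  refine tendsto_of_tendsto_of_tendsto_of_le_of_le' tendsto_const_nhds hlim
    (Eventually.of_forall fun x => (h.deriv_pos x).le) ?_
  obtain ⟨x₀, hx₀⟩ := (h.tendsto_atTop.eventually (lt_mem_nhds hg.mem_Ioo.2)).exists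
  filter_upwards [eventually_ge_atTop (x₀ + 1)] with x hx
  obtain ⟨y, hy, hy'⟩ := exists_hasDerivAt_eq_slope Φ (deriv Φ) (show x - 1 < x by linarith)
    h.differentiable.continuous.continuousOn fun z _ => (h.differentiable z).hasDerivAt
  have hm : AntitoneOn (fun y => deriv Φ y + c * Φ y) (Icc (x - 1) x) := by
    refine antitoneOn_of_deriv_nonpos (convex_Icc _ _)
      (fun z _ => (h.hasDerivAt_add he z).continuousAt.continuousWithinAt)
      (fun z _ => (h.hasDerivAt_add he z).differentiableAt.differentiableWithinAt) fun z hz => ?_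
    rw [interior_Icc] at hz
    rw [(h.hasDerivAt_add he z).deriv]
    have := hg.nonneg ⟨hx₀.trans (h.strictMono (show x₀ < z by linarith [hz.1])), (h.mem_Icc z).2⟩
    linarith
  have h1 := hm (Ioo_subset_Icc_self hy) (right_mem_Icc.2 (by linarith)) hy.2.le
  simp only at h1
  rw [hy'] at h1
  have h2 : -c * (Φ x - Φ y) ≤ |c| * (Φ x - Φ (x - 1)) := by
    have h3 := h.strictMono hy.1
    have h4 := h.strictMono hy.2
    calc _ ≤ |c| * (Φ x - Φ y) := mul_le_mul_of_nonneg_right (neg_le_abs c) (by linarith)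
      _ ≤ _ := mul_le_mul_of_nonneg_left (by linarith) (abs_nonneg c)
  have h5 : (Φ x - Φ (x - 1)) / (x - (x - 1)) = Φ x - Φ (x - 1) := by
    rw [sub_sub_cancel, div_one]
  rw [h5] at h1
  linarith

theorem exists_isFront (h : IsTravellingWave f c Φ) (hg : BistableLipschitz g K α)
    (he : EqOn f g (Icc 0 1)) : ∃ Ψ Q, IsFront g c Φ Ψ Q := by
  have hc := h.differentiable.continuous
  have hli : ∀ x, Function.invFun Φ (Φ x) = x := Function.leftInverse_invFun h.strictMono.injective
  have hri : ∀ s ∈ Ioo (0 : ℝ) 1, Φ (Function.invFun Φ s) = s := by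
    intro s hs
    refine Function.invFun_eq ?_
    obtain ⟨x, hx⟩ := (h.tendsto_atBot.eventually (gt_mem_nhds hs.1)).exists
    obtain ⟨y, hy⟩ := (h.tendsto_atTop.eventually (lt_mem_nhds hs.2)).exists
    exact mem_range_of_exists_le_of_exists_ge hc ⟨x, hx.le⟩ ⟨y, hy.le⟩
  set Ψ := Function.invFun Φ
  have hΨm : StrictMonoOn Ψ (Ioo 0 1) := fun s hs t ht hst => by
    rw [← h.strictMono.lt_iff_lt, hri s hs, hri t ht]; exact hst
  have hΨi : Ψ '' Ioo 0 1 = univ :=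
    eq_univ_of_forall fun x => ⟨Φ x, h.mem_Ioo x, hli x⟩
  have hΨc : ∀ s ∈ Ioo (0 : ℝ) 1, ContinuousAt Ψ s := fun s hs =>
    hΨm.continuousAt_of_image_mem_nhds (Ioo_mem_nhds hs.1 hs.2) (by rw [hΨi]; exact univ_mem)
  have hΨd : ∀ s ∈ Ioo (0 : ℝ) 1, HasDerivAt Ψ (deriv Φ (Ψ s))⁻¹ s := fun s hs =>
    HasDerivAt.of_local_left_inverse (hΨc s hs) (h.differentiable _).hasDerivAt (h.deriv_pos _).ne'
      (by filter_upwards [Ioo_mem_nhds hs.1 hs.2] with t ht using hri t ht)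
  have hΨ0 : Tendsto Ψ (𝓝[>] 0) atBot := by
    refine Filter.tendsto_atBot.2 fun B => ?_
    filter_upwards [Ioo_mem_nhdsGT (h.mem_Ioo B).1] with s hs
    rw [← h.strictMono.le_iff_le, hri s ⟨hs.1, hs.2.trans (h.mem_Ioo B).2⟩]
    exact hs.2.le
  have hΨ1 : Tendsto Ψ (𝓝[<] 1) atTop := by
    refine Filter.tendsto_atTop.2 fun B => ?_
    filter_upwards [Ioo_mem_nhdsLT (h.mem_Ioo B).2] with s hs
    rw [← h.strictMono.le_iff_le, hri s ⟨(h.mem_Ioo B).1.trans hs.1, hs.2⟩]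
    exact hs.1.le
  -- The value `0` at both end heights is the limit of `Φ'` at `∓∞`, which makes `Q` continuous on
  -- `[0,1]`.
  set Q : ℝ → ℝ := (Ioo (0 : ℝ) 1).indicator fun s => deriv Φ (Ψ s)
  have hQe : ∀ s ∈ Ioo (0 : ℝ) 1, Q s = deriv Φ (Ψ s) := fun s hs => indicator_of_mem hs _
  have hQ0 : Q 0 = 0 := indicator_of_notMem (by simp) _
  have hQ1 : Q 1 = 0 := indicator_of_notMem (by simp) _
  have hQd : ∀ s ∈ Ioo (0 : ℝ) 1, HasDerivAt Q (-c - g s / Q s) s := by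
    intro s hs
    have h1 := (h.hasDerivAt_deriv he (Ψ s)).comp s (hΨd s hs)
    have h2 : HasDerivAt Q ((-c * deriv Φ (Ψ s) - g (Φ (Ψ s))) * (deriv Φ (Ψ s))⁻¹) s := by
      refine h1.congr_of_eventuallyEq ?_
      filter_upwards [Ioo_mem_nhds hs.1 hs.2] with t ht using hQe t ht
    refine h2.congr_deriv ?_
    have := (h.deriv_pos (Ψ s)).ne'
    rw [hri s hs, hQe s hs]
    field_simp
  refine ⟨Ψ, Q, h.strictMono, h.mem_Ioo, h.tendsto_atBot, h.tendsto_atTop, fun x => ?_, hli, hri,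
    fun s hs => ?_, fun s hs => ?_, hQ0, hQ1, fun s hs => ?_, hQd⟩
  · rw [hQe _ (h.mem_Ioo x), hli]; exact (h.differentiable x).hasDerivAt
  · rw [hQe s hs]; exact hΨd s hs
  · rcases eq_or_lt_of_le hs.1 with h0 | h0
    · subst h0
      refine ContinuousWithinAt.mono (t := Ici 0) ?_ Icc_subset_Ici_self
      rw [← continuousWithinAt_Ioi_iff_Ici, ContinuousWithinAt, hQ0]
      refine ((h.tendsto_deriv_atBot hg he).comp hΨ0).congr' ?_
      filter_upwards [Ioo_mem_nhdsGT zero_lt_one] with t ht using (hQe t ht).symm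
    rcases eq_or_lt_of_le hs.2 with h1 | h1
    · subst h1
      refine ContinuousWithinAt.mono (t := Iic 1) ?_ Icc_subset_Iic_self
      rw [← continuousWithinAt_Iio_iff_Iic, ContinuousWithinAt, hQ1]
      refine ((h.tendsto_deriv_atTop hg he).comp hΨ1).congr' ?_
      filter_upwards [Ioo_mem_nhdsLT zero_lt_one] with t ht using (hQe t ht).symm
    exact (hQd s ⟨h0, h1⟩).continuousAt.continuousWithinAt
  · rw [hQe s hs]; exact h.deriv_pos _

end IsTravellingWave

namespace IsFront

variable {g : ℝ → ℝ} {c : ℝ} {Φ Ψ Q : ℝ → ℝ}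

theorem hasDerivAt_slope_comp (h : IsFront g c Φ Ψ Q) (x : ℝ) :
    HasDerivAt (fun x => Q (Φ x)) (-c * Q (Φ x) - g (Φ x)) x := by
  refine ((h.hasDerivAt_slope _ (h.mem_Ioo x)).comp x (h.hasDerivAt x)).congr_deriv ?_
  have := (h.slope_pos _ (h.mem_Ioo x)).ne'
  field_simp

theorem continuous (h : IsFront g c Φ Ψ Q) : Continuous Φ :=
  continuous_iff_continuousAt.2 fun x => (h.hasDerivAt x).continuousAt

theorem isPhaseCurve (h : IsFront g c Φ Ψ Q) (a b d : ℝ) :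
    IsPhaseCurve g c a b (fun x => Φ (x + d)) (fun x => Q (Φ (x + d))) where
  continuousOn_fst x _ := ((h.hasDerivAt (x + d)).comp_add_const x d).continuousAt.continuousWithinAt
  continuousOn_snd x _ :=
    ((h.hasDerivAt_slope_comp (x + d)).comp_add_const x d).continuousAt.continuousWithinAt
  hasDerivAt_fst x _ := (h.hasDerivAt (x + d)).comp_add_const x d
  hasDerivAt_snd x _ := (h.hasDerivAt_slope_comp (x + d)).comp_add_const x d

theorem slope_nonneg (h : IsFront g c Φ Ψ Q) {s : ℝ} (hs : s ∈ Icc (0 : ℝ) 1) : 0 ≤ Q s := by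
  rcases eq_or_lt_of_le hs.1 with h0 | h0
  · rw [← h0, h.slope_zero]
  rcases eq_or_lt_of_le hs.2 with h1 | h1
  · rw [h1, h.slope_one]
  exact (h.slope_pos s ⟨h0, h1⟩).le

theorem integral_slope_pos (h : IsFront g c Φ Ψ Q) : 0 < ∫ s in (0 : ℝ)..1, Q s :=
  intervalIntegral.integral_pos zero_lt_one h.continuousOn_slope
    (fun _ hs => h.slope_nonneg (Ioc_subset_Icc_self hs))
    ⟨1 / 2, by norm_num, h.slope_pos _ (by norm_num)⟩

theorem exists_slope_lower_bound (h : IsFront g c Φ Ψ Q) {ε : ℝ} (hε : 0 < ε) :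
    ∃ m > 0, ∀ s ∈ Icc ε (1 - ε), m ≤ Q s := by
  have hsub : Icc ε (1 - ε) ⊆ Ioo 0 1 := fun s hs => ⟨by linarith [hs.1], by linarith [hs.2]⟩
  rcases (Icc ε (1 - ε)).eq_empty_or_nonempty with he | hne
  · exact ⟨1, one_pos, fun s hs => by simp [he] at hs⟩
  obtain ⟨s, hs, hmin⟩ := isCompact_Icc.exists_isMinOn hne
    (h.continuousOn_slope.mono (hsub.trans Ioo_subset_Icc_self))
  exact ⟨Q s, h.slope_pos s (hsub hs), fun t ht => hmin ht⟩

/-- The front and its slope are Lipschitz. -/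
theorem exists_lipschitz (h : IsFront g c Φ Ψ Q) (hg : Continuous g) :
    ∃ L > 0, ∀ x y, |Φ x - Φ y| ≤ L * |x - y| ∧ |Q (Φ x) - Q (Φ y)| ≤ L * |x - y| := by
  obtain ⟨M, hM⟩ := isCompact_Icc.exists_bound_of_continuousOn h.continuousOn_slope
  obtain ⟨N, hN⟩ := isCompact_Icc.exists_bound_of_continuousOn
    (f := fun s => -c * Q s - g s) (s := Icc 0 1)
    ((continuousOn_const.mul h.continuousOn_slope).sub hg.continuousOn)
  refine ⟨max (max M N) 1, by positivity, fun x y => ⟨?_, ?_⟩⟩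
  · exact convex_univ.norm_image_sub_le_of_norm_hasDerivWithin_le
      (fun z _ => (h.hasDerivAt z).hasDerivWithinAt)
      (fun z _ => (hM _ (Ioo_subset_Icc_self (h.mem_Ioo z))).trans
        ((le_max_left _ _).trans (le_max_left _ _))) (mem_univ y) (mem_univ x)
  · exact convex_univ.norm_image_sub_le_of_norm_hasDerivWithin_le
      (fun z _ => (h.hasDerivAt_slope_comp z).hasDerivWithinAt)
      (fun z _ => (hN _ (Ioo_subset_Icc_self (h.mem_Ioo z))).trans
        ((le_max_right _ _).trans (le_max_left _ _))) (mem_univ y) (mem_univ x)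

theorem integrable_slope_comp (h : IsFront g c Φ Ψ Q) :
    Integrable (fun x => Q (Φ x)) ∧ ∫ x, Q (Φ x) = 1 := by
  have hc : Continuous fun x => Q (Φ x) :=
    continuous_iff_continuousAt.2 fun x => (h.hasDerivAt_slope_comp x).continuousAt
  have hi : Integrable (fun x => Q (Φ x)) := by
    refine integrable_of_intervalIntegral_norm_bounded (a := fun n : ℕ => -(n : ℝ))
      (b := fun n : ℕ => (n : ℝ)) (l := atTop) 1 (fun n => hc.integrableOn_Ioc)
      (tendsto_neg_atTop_atBot.comp tendsto_natCast_atTop_atTop) tendsto_natCast_atTop_atTop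
      (Eventually.of_forall fun n => ?_)
    have h1 : ∀ x, ‖Q (Φ x)‖ = Q (Φ x) := fun x =>
      Real.norm_of_nonneg (h.slope_pos _ (h.mem_Ioo x)).le
    simp_rw [h1]
    rw [intervalIntegral.integral_eq_sub_of_hasDerivAt (fun x _ => h.hasDerivAt x)
      (hc.intervalIntegrable _ _)]
    linarith [(h.mem_Ioo n).2, (h.mem_Ioo (-n)).1]
  refine ⟨hi, ?_⟩
  rw [integral_of_hasDerivAt_of_tendsto h.hasDerivAt hi h.tendsto_atBot h.tendsto_atTop, sub_zero]

end IsFront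

/-! ### Comparison of the profile with the front. -/

/-- At a first zero the difference quotients from the left are nonpositive, against a positive
derivative. -/
theorem pos_of_deriv_pos_of_eq_zero {w w' : ℝ → ℝ} {a b : ℝ} (hc : ContinuousOn w (Icc a b))
    (ha : 0 < w a) (hd : ∀ x ∈ Ioo a b, HasDerivAt w (w' x) x)
    (hz : ∀ x ∈ Ioo a b, w x = 0 → 0 < w' x) : ∀ x ∈ Ioo a b, 0 < w x := by
  by_contra! hcon
  obtain ⟨y, hy, hwy⟩ := hcon
  have hcy := hc.mono (Icc_subset_Icc_right hy.2.le)
  have hK : IsCompact {x ∈ Icc a y | w x ≤ 0} :=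
    isCompact_Icc.of_isClosed_subset
      (hcy.preimage_isClosed_of_isClosed isClosed_Icc isClosed_Iic) inter_subset_left
  obtain ⟨x, ⟨hx, hwx⟩, hmin⟩ := hK.exists_isLeast ⟨y, right_mem_Icc.2 hy.1.le, hwy⟩
  have hax : a < x := lt_of_le_of_ne hx.1 fun h => by rw [h] at ha; linarith
  have hxI : x ∈ Ioo a b := ⟨hax, hx.2.trans_lt hy.2⟩
  have hpos : ∀ z ∈ Ioo a x, 0 < w z := fun z hz => by
    by_contra! h
    linarith [hmin ⟨⟨hz.1.le, hz.2.le.trans hx.2⟩, h⟩, hz.2]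
  have hev : ∀ᶠ z in 𝓝[<] x, 0 < w z := by
    filter_upwards [Ioo_mem_nhdsLT hax] with z hz using hpos z hz
  have h0 : w x = 0 := le_antisymm hwx
    (ge_of_tendsto ((hd x hxI).continuousAt.tendsto.mono_left nhdsWithin_le_nhds)
      (hev.mono fun _ h => h.le))
  have hs := ((hasDerivWithinAt_iff_tendsto_slope' (by simp)).1
    ((hd x hxI).hasDerivWithinAt (s := Iio x))).eventually (lt_mem_nhds (hz x hxI h0))
  obtain ⟨z, h1, h2, h3⟩ := (hs.and (hev.and (self_mem_nhdsWithin (a := x) (s := Iio x)))).exists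
  rw [slope_def_field, h0, sub_zero] at h1
  exact absurd h1 (not_lt.2 (div_nonpos_of_nonneg_of_nonpos h2.le (sub_nonpos.2 (le_of_lt h3))))

namespace IsProfile

variable {g : ℝ → ℝ} {K : NNReal} {α lam c a b p : ℝ} {u v Φ Ψ Q : ℝ → ℝ}

theorem mem_Icc (h : IsProfile g lam a b p u v) : ∀ x ∈ Icc a b, u x ∈ Icc (0 : ℝ) 1 := by
  intro x hx
  rcases eq_or_lt_of_le hx.1 with h0 | h0
  · rw [← h0, h.left]; simp
  rcases eq_or_lt_of_le hx.2 with h1 | h1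
  · rw [h1, h.right]; simp
  exact Ioo_subset_Icc_self (h.mem_Ioo x ⟨h0, h1⟩)

/-- The excess of the slope of the profile over that of the front at the same height. -/
theorem continuousOn_excess (h : IsProfile g lam a b p u v) (hF : IsFront g c Φ Ψ Q) :
    ContinuousOn (fun x => v x - Q (u x)) (Icc a b) :=
  h.continuousOn_snd.sub (hF.continuousOn_slope.comp h.continuousOn_fst h.mem_Icc)

theorem hasDerivAt_excess (h : IsProfile g lam a b p u v) (hF : IsFront g c Φ Ψ Q) {x : ℝ}
    (hx : x ∈ Ioo a b) : HasDerivAt (fun x => v x - Q (u x))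
      ((c - lam) * v x + g (u x) / Q (u x) * (v x - Q (u x))) x := by
  refine ((h.hasDerivAt_snd x hx).fun_sub ((hF.hasDerivAt_slope _ (h.mem_Ioo x hx)).comp x
    (h.hasDerivAt_fst x hx))).congr_deriv ?_
  have := (hF.slope_pos _ (h.mem_Ioo x hx)).ne'
  field_simp
  ring

theorem excess_left (h : IsProfile g lam a b p u v) (hF : IsFront g c Φ Ψ Q) :
    v a - Q (u a) = p := by rw [h.left, hF.slope_zero, h.slope_left, sub_zero]

theorem excess_right (h : IsProfile g lam a b p u v) (hF : IsFront g c Φ Ψ Q) :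
    v b - Q (u b) = p := by rw [h.right, hF.slope_one, h.slope_right, sub_zero]

/-- At a zero of the excess its derivative is `(c - lam) v`, with `v = Q(u) > 0`. So the comparison
runs from the left end if `lam < c` and from the right end if `lam > c`. If `lam = c`, a zero would
make the profile a translate of the front, which never reaches `1`. -/
theorem slope_lt (h : IsProfile g lam a b p u v) (hF : IsFront g c Φ Ψ Q)
    (hg : BistableLipschitz g K α) : ∀ x ∈ Ioo a b, Q (u x) < v x := by
  suffices hs : ∀ x ∈ Ioo a b, 0 < v x - Q (u x) from fun x hx => sub_pos.1 (hs x hx)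
  have hc := h.continuousOn_excess hF
  have hQ : ∀ x ∈ Ioo a b, v x - Q (u x) = 0 → 0 < v x := fun x hx h0 => by
    rw [sub_eq_zero.1 h0]; exact hF.slope_pos _ (h.mem_Ioo x hx)
  rcases lt_trichotomy lam c with hlt | heq | hgt
  · refine pos_of_deriv_pos_of_eq_zero hc (by rw [h.excess_left hF]; exact h.slope_pos)
      (fun x hx => h.hasDerivAt_excess hF hx) fun x hx h0 => ?_
    rw [h0, mul_zero, add_zero]
    exact mul_pos (by linarith) (hQ x hx h0)
  · intro x hx
    by_contra! hneg
    obtain ⟨y, hy, hy0⟩ := intermediate_value_Icc' hx.1.le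
      (hc.mono (Icc_subset_Icc_right hx.2.le)) (show (0 : ℝ) ∈ _ from
        ⟨hneg, by rw [h.excess_left hF]; exact h.slope_pos.le⟩)
    simp only at hy0
    have hay : a < y := lt_of_le_of_ne hy.1 fun h1 => by
      rw [← h1, h.excess_left hF] at hy0; exact h.slope_pos.ne' hy0
    have hyI : y ∈ Ioo a b := ⟨hay, hy.2.trans_lt hx.2⟩
    have he : Φ (y + (Ψ (u y) - y)) = u y := by
      rw [add_sub_cancel, hF.right_inv _ (h.mem_Ioo y hyI)]
    have h1 := (h.toIsPhaseCurve.mono hay.le le_rfl).unique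
      (heq ▸ hF.isPhaseCurve y b (Ψ (u y) - y)) hg.lipschitz he.symm (by
        rw [he]; linarith) (right_mem_Icc.2 hyI.2.le)
    simp only [h.right] at h1
    exact (hF.mem_Ioo _).2.ne h1.symm
  · have hsub : ∀ x ∈ Ioo (-b) (-a), -x ∈ Ioo a b := fun x hx =>
      ⟨by linarith [hx.2], by linarith [hx.1]⟩
    have key := pos_of_deriv_pos_of_eq_zero (a := -b) (b := -a)
      (w := fun x => v (-x) - Q (u (-x)))
      (w' := fun x => -((c - lam) * v (-x) + g (u (-x)) / Q (u (-x)) * (v (-x) - Q (u (-x)))))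
      (hc.comp continuousOn_neg fun x hx => ⟨by linarith [hx.2], by linarith [hx.1]⟩)
      (by simp only [neg_neg]; rw [h.excess_right hF]; exact h.slope_pos)
      (fun x hx => by
        refine ((h.hasDerivAt_excess hF (hsub x hx)).comp x (hasDerivAt_neg x)).congr_deriv ?_
        ring) fun x hx h0 => by
        rw [h0, mul_zero, add_zero]
        nlinarith [hQ _ (hsub x hx) h0]
    intro x hx
    simpa using key (-x) ⟨by linarith [hx.2], by linarith [hx.1]⟩

theorem deriv_pos (h : IsProfile g lam a b p u v) (hF : IsFront g c Φ Ψ Q)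
    (hg : BistableLipschitz g K α) {x : ℝ} (hx : x ∈ Icc a b) : 0 < v x := by
  rcases eq_or_lt_of_le hx.1 with h0 | h0
  · rw [← h0, h.slope_left]; exact h.slope_pos
  rcases eq_or_lt_of_le hx.2 with h1 | h1
  · rw [h1, h.slope_right]; exact h.slope_pos
  exact (hF.slope_pos _ (h.mem_Ioo x ⟨h0, h1⟩)).trans (h.slope_lt hF hg x ⟨h0, h1⟩)

theorem slope_le (h : IsProfile g lam a b p u v) (hF : IsFront g c Φ Ψ Q)
    (hg : BistableLipschitz g K α) {x : ℝ} (hx : x ∈ Icc a b) : Q (u x) ≤ v x := by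
  rcases eq_or_lt_of_le hx.1 with h0 | h0
  · rw [← h0, h.left, hF.slope_zero, h.slope_left]; exact h.slope_pos.le
  rcases eq_or_lt_of_le hx.2 with h1 | h1
  · rw [h1, h.right, hF.slope_one, h.slope_right]; exact h.slope_pos.le
  exact (h.slope_lt hF hg x ⟨h0, h1⟩).le

theorem strictMonoOn (h : IsProfile g lam a b p u v) (hF : IsFront g c Φ Ψ Q)
    (hg : BistableLipschitz g K α) : StrictMonoOn u (Icc a b) := by
  refine strictMonoOn_of_deriv_pos (convex_Icc _ _) h.continuousOn_fst fun x hx => ?_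
  rw [interior_Icc] at hx
  rw [(h.hasDerivAt_fst x hx).deriv]
  exact h.deriv_pos hF hg (Ioo_subset_Icc_self hx)

theorem exists_eq (h : IsProfile g lam a b p u v) {s : ℝ} (hs : s ∈ Ioo (0 : ℝ) 1) :
    ∃ x ∈ Ioo a b, u x = s :=
  intermediate_value_Ioo h.lt.le h.continuousOn_fst (by rwa [h.left, h.right])

/-- Both the excess slope and the error of the speed are controlled by the slope at the ends. -/
theorem abs_speed_sub_le (h : IsProfile g lam a b p u v) (hF : IsFront g c Φ Ψ Q)
    (hg : BistableLipschitz g K α) :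
    |c - lam| ≤ p / (α * (1 - α)) ∧
      ∀ x ∈ Icc a b, v x - Q (u x) ≤ p * (1 + 1 / (α * (1 - α))) := by
  have hα := hg.mem_Ioo
  obtain ⟨y, hy, hyα⟩ := h.exists_eq hα
  have hyI := Ioo_subset_Icc_self hy
  have hmono := h.strictMonoOn hF hg
  -- Subtracting `(c - lam) u` removes the forcing term; what is left of the derivative has the sign
  -- of `g(u)`.
  have hc : ContinuousOn (fun x => v x - Q (u x) - (c - lam) * u x) (Icc a b) :=
    (h.continuousOn_excess hF).sub (continuousOn_const.mul h.continuousOn_fst)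
  have hd : ∀ x ∈ Ioo a b, HasDerivAt (fun x => v x - Q (u x) - (c - lam) * u x)
      (g (u x) / Q (u x) * (v x - Q (u x))) x := fun x hx =>
    ((h.hasDerivAt_excess hF hx).fun_sub ((h.hasDerivAt_fst x hx).const_mul _)).congr_deriv (by ring)
  have hl : AntitoneOn (fun x => v x - Q (u x) - (c - lam) * u x) (Icc a y) := by
    refine antitoneOn_of_deriv_nonpos (convex_Icc _ _) (hc.mono (Icc_subset_Icc_right hy.2.le))
      (fun x hx => ?_) fun x hx => ?_ <;> rw [interior_Icc] at hx
    · exact (hd x ⟨hx.1, hx.2.trans hy.2⟩).differentiableAt.differentiableWithinAt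
    · have hx' : x ∈ Ioo a b := ⟨hx.1, hx.2.trans hy.2⟩
      rw [(hd x hx').deriv]
      have hux : u x < α := hyα ▸ hmono (Ioo_subset_Icc_self hx') hyI hx.2
      exact mul_nonpos_of_nonpos_of_nonneg (div_nonpos_of_nonpos_of_nonneg
        (hg.nonpos ⟨(h.mem_Ioo x hx').1.le, hux⟩) (hF.slope_pos _ (h.mem_Ioo x hx')).le)
        (sub_nonneg.2 (h.slope_lt hF hg x hx').le)
  have hr : MonotoneOn (fun x => v x - Q (u x) - (c - lam) * u x) (Icc y b) := by
    refine monotoneOn_of_deriv_nonneg (convex_Icc _ _) (hc.mono (Icc_subset_Icc_left hy.1.le))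
      (fun x hx => ?_) fun x hx => ?_ <;> rw [interior_Icc] at hx
    · exact (hd x ⟨hy.1.trans hx.1, hx.2⟩).differentiableAt.differentiableWithinAt
    · have hx' : x ∈ Ioo a b := ⟨hy.1.trans hx.1, hx.2⟩
      rw [(hd x hx').deriv]
      have hux : α < u x := hyα ▸ hmono hyI (Ioo_subset_Icc_self hx') hx.1
      exact mul_nonneg (div_nonneg
        (hg.nonneg ⟨hux, (h.mem_Ioo x hx').2.le⟩) (hF.slope_pos _ (h.mem_Ioo x hx')).le)
        (sub_nonneg.2 (h.slope_lt hF hg x hx').le)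
  have hl' : ∀ x ∈ Icc a y, v x - Q (u x) ≤ p + (c - lam) * u x := fun x hx => by
    have := hl (left_mem_Icc.2 hy.1.le) hx hx.1
    simp only at this
    rw [h.excess_left hF, h.left] at this
    linarith
  have hr' : ∀ x ∈ Icc y b, v x - Q (u x) ≤ p - (c - lam) * (1 - u x) := fun x hx => by
    have := hr hx (right_mem_Icc.2 hy.2.le) hx.2
    simp only at this
    rw [h.excess_right hF, h.right] at this
    linarith
  have h1 := hl' y (right_mem_Icc.2 hy.1.le)
  have h2 := hr' y (left_mem_Icc.2 hy.2.le)
  have h3 := h.slope_lt hF hg y hy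
  rw [hyα] at h1 h2 h3
  have hα0 := hα.1
  have hα1 : 0 < 1 - α := by linarith [hα.2]
  have hp := h.slope_pos
  -- Positivity of the excess at height `α` turns the bounds from the two ends into `lam - c ≤ p /
  -- α` and `c - lam ≤ p / (1 - α)`.
  have hk : |c - lam| ≤ p / (α * (1 - α)) := by
    rw [le_div_iff₀ (by positivity)]
    rcases abs_cases (c - lam) with ⟨h4, h5⟩ | ⟨h4, h5⟩ <;> rw [h4]
    · have h6 : (c - lam) * (1 - α) ≤ p := by linarith
      nlinarith [mul_le_mul_of_nonneg_left h6 hα0.le]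
    · have h6 : -(c - lam) * α ≤ p := by linarith
      nlinarith [mul_le_mul_of_nonneg_right h6 hα1.le]
  refine ⟨hk, fun x hx => ?_⟩
  have hu := h.mem_Icc x hx
  have h4 : v x - Q (u x) ≤ p + |c - lam| := by
    rcases le_total x y with hxy | hxy
    · have := hl' x ⟨hx.1, hxy⟩
      nlinarith [mul_le_mul_of_nonneg_right (le_abs_self (c - lam)) hu.1,
        mul_le_mul_of_nonneg_left hu.2 (abs_nonneg (c - lam))]
    · have := hr' x ⟨hxy, hx.2⟩
      nlinarith [mul_le_mul_of_nonneg_right (neg_abs_le (c - lam)) (sub_nonneg.2 hu.2),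
        mul_nonneg hu.1 (abs_nonneg (c - lam))]
  calc _ ≤ p + |c - lam| := h4
    _ ≤ p + p / (α * (1 - α)) := by linarith
    _ = _ := by ring

/-- As `v ≥ Q(u)`, the denominator of the speed satisfies `∫ v² ≥ ∫ Q(u) u' = ∫₀¹ Q`, independently
of the interval. -/
theorem abs_speed_le (h : IsProfile g lam a b p u v) (hF : IsFront g c Φ Ψ Q)
    (hg : BistableLipschitz g K α) :
    |lam| ≤ |∫ s in (0 : ℝ)..1, g s| / ∫ s in (0 : ℝ)..1, Q s := by
  have hab := h.lt.le
  have hQu : ContinuousOn (Q ∘ u) (Icc a b) := hF.continuousOn_slope.comp h.continuousOn_fst h.mem_Icc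
  have h1 : ∫ x in a..b, (Q ∘ u) x * v x = ∫ s in (0 : ℝ)..1, Q s := by
    rw [intervalIntegral.integral_comp_mul_deriv'' (by rw [uIcc_of_le hab]; exact h.continuousOn_fst)
      (f' := v) ?_ (by rw [uIcc_of_le hab]; exact h.continuousOn_snd)
      (hF.continuousOn_slope.mono ?_), h.left, h.right]
    · intro x hx
      rw [min_eq_left hab, max_eq_right hab] at hx
      exact (h.hasDerivAt_fst x hx).hasDerivWithinAt
    · rw [uIcc_of_le hab]
      exact image_subset_iff.2 h.mem_Icc
  have h2 : ∫ s in (0 : ℝ)..1, Q s ≤ ∫ x in a..b, v x ^ 2 := by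
    rw [← h1]
    refine intervalIntegral.integral_mono_on hab
      ((hQu.mul h.continuousOn_snd).intervalIntegrable_of_Icc hab)
      ((h.continuousOn_snd.pow 2).intervalIntegrable_of_Icc hab) fun x hx => ?_
    rw [sq]
    exact mul_le_mul_of_nonneg_right (h.slope_le hF hg hx) (h.deriv_pos hF hg hx).le
  have h3 := hF.integral_slope_pos
  rw [le_div_iff₀ h3, ← abs_neg (∫ s in (0 : ℝ)..1, g s), ← h.speed, abs_mul]
  exact mul_le_mul_of_nonneg_left (h2.trans (le_abs_self _)) (abs_nonneg _)

/-- Near its ends the slope of a profile is at least `p` minus a multiple of the height. -/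
theorem sub_le_slope (h : IsProfile g lam a b p u v) (hF : IsFront g c Φ Ψ Q)
    (hg : BistableLipschitz g K α) {x : ℝ} (hx : x ∈ Icc a b) :
    (u x < α → p - |lam| * u x ≤ v x) ∧ (α < u x → p - |lam| * (1 - u x) ≤ v x) := by
  have hmono := (h.strictMonoOn hF hg).monotoneOn
  have hc : ContinuousOn (fun x => v x + lam * u x) (Icc a b) :=
    h.continuousOn_snd.add (continuousOn_const.mul h.continuousOn_fst)
  have hd : ∀ x ∈ Ioo a b, HasDerivAt (fun x => v x + lam * u x) (-g (u x)) x := fun x hx =>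
    ((h.hasDerivAt_snd x hx).fun_add ((h.hasDerivAt_fst x hx).const_mul _)).congr_deriv (by ring)
  have hu := h.mem_Icc x hx
  constructor <;> intro hxα
  · have hl : MonotoneOn (fun x => v x + lam * u x) (Icc a x) := by
      refine monotoneOn_of_deriv_nonneg (convex_Icc _ _) (hc.mono (Icc_subset_Icc_right hx.2))
        (fun y hy => ?_) fun y hy => ?_ <;> rw [interior_Icc] at hy <;>
        have hy' : y ∈ Ioo a b := ⟨hy.1, hy.2.trans_le hx.2⟩
      · exact (hd y hy').differentiableAt.differentiableWithinAt
      · rw [(hd y hy').deriv]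
        have := hg.nonpos ⟨(h.mem_Ioo y hy').1.le,
          (hmono (Ioo_subset_Icc_self hy') hx hy.2.le).trans_lt hxα⟩
        linarith
    have := hl (left_mem_Icc.2 hx.1) (right_mem_Icc.2 hx.1) hx.1
    simp only [h.left, h.slope_left] at this
    nlinarith [mul_le_mul_of_nonneg_right (le_abs_self lam) hu.1]
  · have hr : AntitoneOn (fun x => v x + lam * u x) (Icc x b) := by
      refine antitoneOn_of_deriv_nonpos (convex_Icc _ _) (hc.mono (Icc_subset_Icc_left hx.1))
        (fun y hy => ?_) fun y hy => ?_ <;> rw [interior_Icc] at hy <;>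
        have hy' : y ∈ Ioo a b := ⟨hx.1.trans_lt hy.1, hy.2⟩
      · exact (hd y hy').differentiableAt.differentiableWithinAt
      · rw [(hd y hy').deriv]
        have := hg.nonneg ⟨hxα.trans_le (hmono hx (Ioo_subset_Icc_self hy') hy.1.le),
          (h.mem_Ioo y hy').2.le⟩
        linarith
    have := hr (left_mem_Icc.2 hx.2) (right_mem_Icc.2 hx.2) hx.2
    simp only [h.right, h.slope_right] at this
    nlinarith [mul_le_mul_of_nonneg_right (neg_abs_le lam) (sub_nonneg.2 hu.2)]

end IsProfile

/-! ### Decay of the end slope. -/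

/-- The slope at the ends of a profile tends to zero as the interval length tends to infinity. -/
theorem IsFront.exists_length_slope_lt {g : ℝ → ℝ} {K : NNReal} {α c : ℝ} {Φ Ψ Q : ℝ → ℝ}
    (hF : IsFront g c Φ Ψ Q) (hg : BistableLipschitz g K α) {δ : ℝ} (hδ : 0 < δ) :
    ∃ R : ℝ, ∀ (lam a b p : ℝ) (u v : ℝ → ℝ), IsProfile g lam a b p u v → R < b - a → p < δ := by
  set Λ := |∫ s in (0 : ℝ)..1, g s| / ∫ s in (0 : ℝ)..1, Q s
  have hΛ : 0 ≤ Λ := div_nonneg (abs_nonneg _) hF.integral_slope_pos.le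
  have hα := hg.mem_Ioo
  have hα0 := hα.1
  have hα1 : 0 < 1 - α := by linarith [hα.2]
  -- Within `η` of the end heights `g` has a fixed sign, and the possible loss `Λ η` of slope is at
  -- most `δ / 2`.
  obtain ⟨η, hη, hη1, hη2, hη3⟩ : ∃ η > 0, η < α ∧ η < 1 - α ∧ Λ * η ≤ δ / 2 := by
    refine ⟨min (min (α / 2) ((1 - α) / 2)) (δ / (2 * (Λ + 1))), by positivity, ?_, ?_, ?_⟩
    · exact ((min_le_left _ _).trans (min_le_left _ _)).trans_lt (by linarith)
    · exact ((min_le_left _ _).trans (min_le_right _ _)).trans_lt (by linarith)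
    · calc _ ≤ Λ * (δ / (2 * (Λ + 1))) := mul_le_mul_of_nonneg_left (min_le_right _ _) hΛ
        _ ≤ (Λ + 1) * (δ / (2 * (Λ + 1))) := mul_le_mul_of_nonneg_right (by linarith) (by positivity)
        _ = δ / 2 := by field_simp
  obtain ⟨m, hm, hmQ⟩ := hF.exists_slope_lower_bound hη
  -- If `p ≥ δ`, the slope is at least `min m (δ / 2)` everywhere, while its mean is `1 / (b - a)`.
  refine ⟨1 / min m (δ / 2), fun lam a b p u v h hR => ?_⟩
  by_contra! hp
  have hlam := h.abs_speed_le hF hg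
  have hlow : ∀ x ∈ Icc a b, min m (δ / 2) ≤ v x := by
    intro x hx
    have hu := h.mem_Icc x hx
    rcases lt_or_ge (u x) η with h1 | h1
    · refine (min_le_right _ _).trans (le_trans ?_ ((h.sub_le_slope hF hg hx).1 (h1.trans hη1)))
      have : |lam| * u x ≤ Λ * η := mul_le_mul hlam h1.le hu.1 hΛ
      linarith
    rcases lt_or_ge (1 - η) (u x) with h2 | h2
    · refine (min_le_right _ _).trans
        (le_trans ?_ ((h.sub_le_slope hF hg hx).2 (by linarith)))
      have : |lam| * (1 - u x) ≤ Λ * η := mul_le_mul hlam (by linarith) (by linarith [hu.2]) hΛ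
      linarith
    · exact (min_le_left _ _).trans ((hmQ _ ⟨h1, h2⟩).trans (h.slope_le hF hg hx))
  have hmin : 0 < min m (δ / 2) := lt_min hm (by linarith)
  have hlen : 0 < b - a := by linarith [h.lt]
  obtain ⟨x, hx, hx'⟩ := exists_hasDerivAt_eq_slope u v h.lt h.continuousOn_fst h.hasDerivAt_fst
  have h3 := hlow x (Ioo_subset_Icc_self hx)
  rw [hx', h.left, h.right, sub_zero, le_div_iff₀ hlen] at h3
  rw [div_lt_iff₀ hmin] at hR
  linarith

/-! ### Uniform closeness of the extended profile to the front. -/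

theorem extendZeroOne_of_mem {a b x : ℝ} {u : ℝ → ℝ} (hx : x ∈ Icc a b) :
    extendZeroOne a b u x = u x := by
  simp [extendZeroOne, not_lt.2 hx.1, hx.2]

theorem extendZeroOne_of_lt {a b x : ℝ} {u : ℝ → ℝ} (hx : x < a) : extendZeroOne a b u x = 0 := by
  simp [extendZeroOne, hx]

theorem extendZeroOne_of_gt {a b x : ℝ} {u : ℝ → ℝ} (hab : a ≤ b) (hx : b < x) :
    extendZeroOne a b u x = 1 := by
  simp [extendZeroOne, not_lt.2 (hab.trans hx.le), not_le.2 hx]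

namespace IsProfile

variable {g : ℝ → ℝ} {K : NNReal} {α lam c a b p : ℝ} {u v Φ Ψ Q : ℝ → ℝ}

theorem extendZeroOne_mem_Icc (h : IsProfile g lam a b p u v) (x : ℝ) :
    extendZeroOne a b u x ∈ Icc (0 : ℝ) 1 := by
  rcases lt_or_ge x a with h1 | h1
  · simp [extendZeroOne_of_lt h1]
  rcases lt_or_ge b x with h2 | h2
  · simp [extendZeroOne_of_gt h.lt.le h2]
  · rw [extendZeroOne_of_mem ⟨h1, h2⟩]; exact h.mem_Icc x ⟨h1, h2⟩

theorem monotone_extendZeroOne (h : IsProfile g lam a b p u v) (hF : IsFront g c Φ Ψ Q)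
    (hg : BistableLipschitz g K α) : Monotone (extendZeroOne a b u) := by
  intro x y hxy
  rcases lt_or_ge x a with h1 | h1
  · rw [extendZeroOne_of_lt h1]; exact (h.extendZeroOne_mem_Icc y).1
  rcases lt_or_ge b y with h2 | h2
  · rw [extendZeroOne_of_gt h.lt.le h2]; exact (h.extendZeroOne_mem_Icc x).2
  · rw [extendZeroOne_of_mem ⟨h1, hxy.trans h2⟩, extendZeroOne_of_mem ⟨h1.trans hxy, h2⟩]
    exact (h.strictMonoOn hF hg).monotoneOn ⟨h1, hxy.trans h2⟩ ⟨h1.trans hxy, h2⟩ hxy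

/-- Between heights at which the front is steeper than `m`, the front and the profile drift apart
by at most a multiple of the excess slope. -/
theorem abs_drift_le (h : IsProfile g lam a b p u v) (hF : IsFront g c Φ Ψ Q)
    (hg : BistableLipschitz g K α) {ε m B x y : ℝ} (hm : 0 < m)
    (hQ : ∀ s ∈ Icc ε (1 - ε), m ≤ Q s) (hB : ∀ x ∈ Icc a b, v x - Q (u x) ≤ B)
    (hx : x ∈ Ioo a b) (hy : y ∈ Ioo a b) (hux : ε ≤ u x) (huy : u y ≤ 1 - ε) (hxy : x < y) :
    |(Ψ (u y) - y) - (Ψ (u x) - x)| ≤ B / m ^ 2 := by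
  have hsub : Icc x y ⊆ Ioo a b := fun z hz => ⟨hx.1.trans_le hz.1, hz.2.trans_lt hy.2⟩
  have hd : ∀ z ∈ Icc x y, HasDerivAt (fun z => Ψ (u z) - z) ((v z - Q (u z)) / Q (u z)) z := by
    intro z hz
    refine (((hF.hasDerivAt_inv _ (h.mem_Ioo z (hsub hz))).comp z
      (h.hasDerivAt_fst z (hsub hz))).fun_sub (hasDerivAt_id z)).congr_deriv ?_
    have := (hF.slope_pos _ (h.mem_Ioo z (hsub hz))).ne'
    field_simp
  have hmono := (h.strictMonoOn hF hg).monotoneOn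
  have hI : ∀ z ∈ Icc x y, z ∈ Icc a b := fun z hz => Ioo_subset_Icc_self (hsub hz)
  -- Cauchy's mean value theorem measures the drift against `u`, whose increase is at most `1`, so
  -- the length `y - x` does not enter.
  obtain ⟨z, hz, he⟩ := exists_ratio_hasDerivAt_eq_ratio_slope (fun z => Ψ (u z) - z) _ hxy
    (fun z hz => (hd z hz).continuousAt.continuousWithinAt)
    (fun z hz => hd z (Ioo_subset_Icc_self hz)) u v
    (h.continuousOn_fst.mono hI) (fun z hz => h.hasDerivAt_fst z (hsub (Ioo_subset_Icc_self hz)))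
  have hz' := Ioo_subset_Icc_self hz
  have hv := h.deriv_pos hF hg (hI z hz')
  have hmz : m ≤ Q (u z) := hQ _
    ⟨hux.trans (hmono (Ioo_subset_Icc_self hx) (hI z hz') hz'.1),
      (hmono (hI z hz') (Ioo_subset_Icc_self hy) hz'.2).trans huy⟩
  have hle := h.slope_le hF hg (hI z hz')
  have hB0 : 0 ≤ B := (sub_nonneg.2 hle).trans (hB z (hI z hz'))
  have hq : 0 < Q (u z) := hm.trans_le hmz
  have h1 : 0 ≤ u y - u x := sub_nonneg.2 (hmono (hI x (left_mem_Icc.2 hxy.le))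
    (hI y (right_mem_Icc.2 hxy.le)) hxy.le)
  have h2 : u y - u x ≤ 1 := by
    linarith [(h.mem_Ioo x hx).1, (h.mem_Ioo y hy).2]
  have h3 : (Ψ (u y) - y) - (Ψ (u x) - x) = (u y - u x) * ((v z - Q (u z)) / Q (u z) / v z) := by
    rw [← mul_div_assoc, he, mul_div_cancel_right₀ _ hv.ne']
  have h4 : 0 ≤ (v z - Q (u z)) / Q (u z) / v z :=
    div_nonneg (div_nonneg (sub_nonneg.2 hle) hq.le) hv.le
  rw [h3, abs_of_nonneg (mul_nonneg h1 h4)]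
  calc _ ≤ 1 * ((v z - Q (u z)) / Q (u z) / v z) := mul_le_mul_of_nonneg_right h2 h4
    _ = (v z - Q (u z)) / (Q (u z) * v z) := by rw [one_mul, div_div]
    _ ≤ B / m ^ 2 := by
        refine div_le_div₀ hB0 (hB z (hI z hz')) (by positivity) ?_
        rw [sq]
        exact mul_le_mul hmz (hmz.trans hle) hm.le hq.le

end IsProfile

/-- The margin is `2 * ε` because where the profile has height `ε` the front is only known to be
within `ε` of it. -/
theorem IsFront.exists_small_slope {g : ℝ → ℝ} {c : ℝ} {Φ Ψ Q : ℝ → ℝ}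
    (hF : IsFront g c Φ Ψ Q) {η : ℝ} (hη : 0 < η) :
    ∃ ε > 0, ε ≤ η ∧ ε < 1 / 4 ∧ ∀ s ∈ Icc (0 : ℝ) 1, s ≤ 2 * ε ∨ 1 - 2 * ε ≤ s → Q s ≤ η := by
  have hc := hF.continuousOn_slope
  obtain ⟨d₀, hd₀, h₀⟩ := Metric.continuousWithinAt_iff.1 (hc 0 (by simp)) η hη
  obtain ⟨d₁, hd₁, h₁⟩ := Metric.continuousWithinAt_iff.1 (hc 1 (by simp)) η hη
  refine ⟨min (min η (1 / 5)) (min (d₀ / 3) (d₁ / 3)), by positivity,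
    (min_le_left _ _).trans (min_le_left _ _),
    ((min_le_left _ _).trans (min_le_right _ _)).trans_lt (by norm_num), fun s hs hor => ?_⟩
  have e₀ : min (min η (1 / 5)) (min (d₀ / 3) (d₁ / 3)) ≤ d₀ / 3 :=
    (min_le_right _ _).trans (min_le_left _ _)
  have e₁ : min (min η (1 / 5)) (min (d₀ / 3) (d₁ / 3)) ≤ d₁ / 3 :=
    (min_le_right _ _).trans (min_le_right _ _)
  rcases hor with h | h
  · have := h₀ hs (by rw [Real.dist_eq, sub_zero, abs_of_nonneg hs.1]; linarith)
    rw [hF.slope_zero, Real.dist_eq, sub_zero] at this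
    exact (le_abs_self _).trans this.le
  · have := h₁ hs (by rw [Real.dist_eq, abs_sub_comm, abs_of_nonneg (by linarith [hs.2])]; linarith)
    rw [hF.slope_one, Real.dist_eq, sub_zero] at this
    exact (le_abs_self _).trans this.le

/-- Normalized profiles on long intervals are uniformly close to the front, together with their
slopes. -/
theorem IsFront.exists_length_uniform_close {g : ℝ → ℝ} {K : NNReal} {α c : ℝ} {Φ Ψ Q : ℝ → ℝ}
    (hF : IsFront g c Φ Ψ Q) (hg : BistableLipschitz g K α) (hΦ : Φ 0 = 1 / 2) {η : ℝ}
    (hη : 0 < η) :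
    ∃ R : ℝ, ∀ (lam a b p : ℝ) (u v : ℝ → ℝ), IsProfile g lam a b p u v → R < b - a →
      (0 : ℝ) ∈ Ioo a b → u 0 = 1 / 2 → ∀ x, |extendZeroOne a b u x - Φ x| ≤ η ∧
        |(Ioo a b).indicator v x - Q (Φ x)| ≤ η := by
  obtain ⟨L, hL, hLip⟩ := hF.exists_lipschitz hg.lipschitz.continuous
  obtain ⟨ε, hε, hεη, hε4, hQε⟩ := hF.exists_small_slope (show 0 < η / 4 by linarith)
  obtain ⟨m, hm, hmQ⟩ := hF.exists_slope_lower_bound hε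
  have hα0 := hg.mem_Ioo.1
  have hα1 : 0 < 1 - α := by linarith [hg.mem_Ioo.2]
  set C := 1 + 1 / (α * (1 - α))
  have hCpos : 0 < C := by positivity
  -- The excess is at most `p * C`. The first bound makes it negligible among slopes; the second
  -- makes the drift `p * C / m ^ 2`, times the Lipschitz constant `L`, at most `ε`.
  obtain ⟨R, hR⟩ := hF.exists_length_slope_lt hg
    (show 0 < min (η / 4) (ε * m ^ 2 / L) / C by positivity)
  refine ⟨R, fun lam a b p u v h hlen h0 hu0 => ?_⟩
  have hp := hR lam a b p u v h hlen
  rw [lt_div_iff₀ hCpos, lt_min_iff] at hp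
  have hB : ∀ x ∈ Icc a b, v x - Q (u x) ≤ p * C := (h.abs_speed_sub_le hF hg).2
  have hdrift : L * (p * C / m ^ 2) ≤ ε := by
    have := hp.2
    rw [lt_div_iff₀ hL] at this
    rw [← mul_div_assoc, div_le_iff₀ (by positivity)]
    linarith
  have hΨ0 : Ψ (1 / 2) = 0 := by rw [← hΦ, hF.left_inv]
  have hmono := h.strictMonoOn hF hg
  have hmid : ∀ x ∈ Ioo a b, ε ≤ u x → u x ≤ 1 - ε →
      |u x - Φ x| ≤ ε ∧ |Q (u x) - Q (Φ x)| ≤ ε := by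
    intro x hx h1 h2
    -- The normalization makes the drift vanish at `0`, and `ε < 1 / 4` keeps the height `1 / 2` in
    -- the middle range.
    have hd : |Ψ (u x) - x| ≤ p * C / m ^ 2 := by
      rcases lt_trichotomy x 0 with hlt | heq | hgt
      · have := h.abs_drift_le hF hg hm hmQ hB hx h0 h1 (by linarith) hlt
        rwa [hu0, hΨ0, sub_zero, zero_sub, abs_neg] at this
      · rw [heq, hu0, hΨ0, sub_zero, abs_zero]
        have := h.slope_pos
        positivity
      · have := h.abs_drift_le hF hg hm hmQ hB h0 hx (by linarith) h2 hgt
        rwa [hu0, hΨ0, sub_zero, sub_zero] at this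
    have h3 := hLip (Ψ (u x)) x
    rw [hF.right_inv _ (h.mem_Ioo x hx)] at h3
    have h4 : L * |Ψ (u x) - x| ≤ ε := (mul_le_mul_of_nonneg_left hd hL.le).trans hdrift
    exact ⟨h3.1.trans h4, h3.2.trans h4⟩
  have hslope : ∀ x, (extendZeroOne a b u x ≤ 2 * ε ∨ 1 - 2 * ε ≤ extendZeroOne a b u x) →
      0 ≤ (Ioo a b).indicator v x ∧ (Ioo a b).indicator v x ≤ η / 2 := by
    intro x hx
    by_cases hxI : x ∈ Ioo a b
    · have hxI' := Ioo_subset_Icc_self hxI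
      rw [indicator_of_mem hxI]
      rw [extendZeroOne_of_mem hxI'] at hx
      have h1 := hQε _ (h.mem_Icc x hxI') hx
      have h2 := hB x hxI'
      exact ⟨(h.deriv_pos hF hg hxI').le, by linarith [hp.1]⟩
    · rw [indicator_of_notMem hxI]
      exact ⟨le_rfl, by linarith⟩
  have htail : ∀ x, (extendZeroOne a b u x ≤ 2 * ε ∧ Φ x ≤ 2 * ε ∨
      1 - 2 * ε ≤ extendZeroOne a b u x ∧ 1 - 2 * ε ≤ Φ x) →
      |extendZeroOne a b u x - Φ x| ≤ η ∧ |(Ioo a b).indicator v x - Q (Φ x)| ≤ η := by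
    intro x hx
    have h1 := hslope x (hx.imp And.left And.left)
    have h2 := hQε _ (Ioo_subset_Icc_self (hF.mem_Ioo x)) (hx.imp And.right And.right)
    have h3 := hF.slope_pos _ (hF.mem_Ioo x)
    have h4 := h.extendZeroOne_mem_Icc x
    have h5 := hF.mem_Ioo x
    refine ⟨abs_le.2 ?_, abs_le.2 ⟨by linarith, by linarith⟩⟩
    rcases hx with hx | hx
    · exact ⟨by linarith [h4.1], by linarith [h5.1]⟩
    · exact ⟨by linarith [h5.2], by linarith [h4.2]⟩
  have hext := h.monotone_extendZeroOne hF hg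
  -- Monotonicity carries the estimates at heights `ε` and `1 - ε` out to the tails, including the
  -- part outside `[a,b]`.
  obtain ⟨y, hy, hye⟩ := h.exists_eq (s := ε) ⟨hε, by linarith⟩
  obtain ⟨z, hz, hze⟩ := h.exists_eq (s := 1 - ε) ⟨by linarith, by linarith⟩
  have hΦy := (abs_le.1 (hmid y hy hye.ge (by linarith)).1).1
  have hΦz := (abs_le.1 (hmid z hz (by linarith) hze.le).1).2
  intro x
  rcases lt_or_ge x y with hxy | hxy
  · refine htail x (Or.inl ⟨?_, ?_⟩)
    · have := hext hxy.le
      rw [extendZeroOne_of_mem (Ioo_subset_Icc_self hy)] at this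
      linarith
    · linarith [hF.strictMono hxy]
  rcases lt_or_ge z x with hxz | hxz
  · refine htail x (Or.inr ⟨?_, ?_⟩)
    · have := hext hxz.le
      rw [extendZeroOne_of_mem (Ioo_subset_Icc_self hz)] at this
      linarith
    · linarith [hF.strictMono hxz]
  have hxI : x ∈ Ioo a b := ⟨hy.1.trans_le hxy, hxz.trans_lt hz.2⟩
  have hxI' := Ioo_subset_Icc_self hxI
  have h1 := hmid x hxI (hye ▸ hmono.monotoneOn (Ioo_subset_Icc_self hy) hxI' hxy)
    (hze ▸ hmono.monotoneOn hxI' (Ioo_subset_Icc_self hz) hxz)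
  rw [extendZeroOne_of_mem hxI', indicator_of_mem hxI]
  refine ⟨h1.1.trans (by linarith), ?_⟩
  have h2 := hB x hxI'
  have h3 := h.slope_le hF hg hxI'
  have h4 := abs_le.1 h1.2
  exact abs_le.2 ⟨by linarith, by linarith [hp.1]⟩

/-! ### Weak derivatives and norms. -/

theorem extendZeroOne_eq_IccExtend {a b : ℝ} {u : ℝ → ℝ} (hab : a ≤ b) (ha : u a = 0)
    (hb : u b = 1) : extendZeroOne a b u = IccExtend hab ((Icc a b).domRestrict u) := by
  ext x
  rcases lt_or_ge x a with h1 | h1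
  · rw [extendZeroOne_of_lt h1, IccExtend_of_le_left _ _ h1.le]; exact ha.symm
  rcases lt_or_ge b x with h2 | h2
  · rw [extendZeroOne_of_gt hab h2, IccExtend_of_right_le _ _ h2.le]; exact hb.symm
  · rw [extendZeroOne_of_mem ⟨h1, h2⟩, IccExtend_of_mem _ _ ⟨h1, h2⟩]; rfl

/-- Integration by parts tolerates countably many exceptional points; here these are the two corners
of the extended profile. -/
theorem hasWeakDeriv_of_hasDerivAt_off_countable {w w' : ℝ → ℝ} {s : Set ℝ} (hs : s.Countable)
    (hc : Continuous w) (hd : ∀ x ∉ s, HasDerivAt w (w' x) x) (hw' : LocallyIntegrable w' volume) :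
    HasWeakDeriv w w' where
  locallyIntegrable := hc.locallyIntegrable
  locallyIntegrable_deriv := hw'
  integral_eq φ hφ hφc := by
    have hφ1 : ContDiff ℝ 1 φ := hφ.of_le (by exact_mod_cast le_top)
    have hφd : ∀ x, HasDerivAt φ (deriv φ x) x := fun x =>
      (hφ1.differentiable one_ne_zero x).hasDerivAt
    have hdc : Continuous (deriv φ) := hφ1.continuous_deriv le_rfl
    have h1 : Integrable fun x => w x * deriv φ x :=
      (hc.mul hdc).integrable_of_hasCompactSupport (hφc.deriv.mul_left)
    have h2 : Integrable fun x => w' x * φ x := by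
      simpa [mul_comm] using hw'.integrable_smul_left_of_hasCompactSupport hφ1.continuous hφc
    obtain ⟨r, hr⟩ := (hφc.isCompact.isBounded).subset_ball 0
    rw [Real.ball_eq_Ioo, zero_sub, zero_add] at hr
    have hsub : ∀ x, x ∉ Ioo (-r) r → φ x = 0 ∧ deriv φ x = 0 := fun x hx =>
      ⟨image_eq_zero_of_notMem_tsupport fun h => hx (hr h),
        image_eq_zero_of_notMem_tsupport fun h => hx (hr (tsupport_deriv_subset h))⟩
    have hI : ∫ x in (-r)..r, (w' x * φ x + w x * deriv φ x) =
        ∫ x, (w' x * φ x + w x * deriv φ x) := by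
      refine intervalIntegral.integral_eq_integral_of_support_subset fun x hx => ?_
      by_contra hx'
      have := hsub x fun h => hx' (Ioo_subset_Ioc_self h)
      simp [this.1, this.2] at hx
    have h3 := integral_eq_of_hasDerivAt_off_countable (fun x => w x * φ x)
      (fun x => w' x * φ x + w x * deriv φ x) (a := -r) (b := r) hs
      (hc.mul hφ1.continuous).continuousOn (fun x hx => (hd x hx.2).fun_mul (hφd x))
      (h2.add h1).intervalIntegrable
    rw [hI, integral_add h2 h1, (hsub r (by simp)).1, (hsub (-r) (by simp)).1] at h3
    linarith

/-- Interpolation: `‖w‖₂² ≤ ‖w‖_∞ ‖w‖₁`. -/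
theorem eLpNorm_two_le_of_bound {w : ℝ → ℝ} {η M : ℝ} (hη : 0 ≤ η) (hw : ∀ x, |w x| ≤ η)
    (hi : Integrable w) (hM : ∫ x, |w x| ≤ M) :
    eLpNorm w 2 volume ≤ ENNReal.ofReal √(η * M) := by
  have h1 : ∫⁻ x, ‖w x‖ₑ ^ (2 : ℝ) ≤ ENNReal.ofReal (η * M) := by
    calc ∫⁻ x, ‖w x‖ₑ ^ (2 : ℝ) ≤ ∫⁻ x, ENNReal.ofReal η * ‖w x‖ₑ := by
          refine lintegral_mono fun x => ?_
          rw [ENNReal.rpow_two, sq]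
          gcongr
          rw [← ofReal_norm]
          exact ENNReal.ofReal_le_ofReal (hw x)
      _ = ENNReal.ofReal η * ENNReal.ofReal (∫ x, ‖w x‖) := by
          rw [lintegral_const_mul'' _ hi.1.enorm, ofReal_integral_norm_eq_lintegral_enorm hi]
      _ ≤ ENNReal.ofReal (η * M) := by
          rw [← ENNReal.ofReal_mul hη]
          exact ENNReal.ofReal_le_ofReal (mul_le_mul_of_nonneg_left hM hη)
  rw [eLpNorm_eq_lintegral_rpow_enorm_toReal two_ne_zero ENNReal.ofNat_ne_top, ENNReal.toReal_ofNat]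
  refine (ENNReal.rpow_le_rpow h1 (by norm_num)).trans ?_
  have hM0 : 0 ≤ M := (integral_nonneg fun x => abs_nonneg _).trans hM
  rw [Real.sqrt_eq_rpow, ENNReal.ofReal_rpow_of_nonneg (mul_nonneg hη hM0) (by norm_num)]

namespace IsProfile

variable {g : ℝ → ℝ} {K : NNReal} {α lam c a b p : ℝ} {u v Φ Ψ Q : ℝ → ℝ}

theorem integrable_indicator (h : IsProfile g lam a b p u v) (hF : IsFront g c Φ Ψ Q)
    (hg : BistableLipschitz g K α) :
    Integrable ((Ioo a b).indicator v) ∧ ∫ x, |(Ioo a b).indicator v x| = 1 := by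
  refine ⟨(integrable_indicator_iff measurableSet_Ioo).2
    ((h.continuousOn_snd.integrableOn_Icc).mono_set Ioo_subset_Icc_self), ?_⟩
  have h1 : (fun x => |(Ioo a b).indicator v x|) = (Ioo a b).indicator v := by
    ext x
    refine abs_of_nonneg (indicator_nonneg (fun y hy => ?_) x)
    exact (h.deriv_pos hF hg (Ioo_subset_Icc_self hy)).le
  rw [h1, integral_indicator measurableSet_Ioo, ← integral_Ioc_eq_integral_Ioo,
    ← intervalIntegral.integral_of_le h.lt.le,
    intervalIntegral.integral_eq_sub_of_hasDerivAt_of_le h.lt.le h.continuousOn_fst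
      h.hasDerivAt_fst (h.continuousOn_snd.intervalIntegrable_of_Icc h.lt.le), h.left, h.right,
    sub_zero]

theorem hasWeakDeriv_sub (h : IsProfile g lam a b p u v) (hF : IsFront g c Φ Ψ Q)
    (hg : BistableLipschitz g K α) :
    HasWeakDeriv (fun x => extendZeroOne a b u x - Φ x)
      (fun x => (Ioo a b).indicator v x - Q (Φ x)) := by
  refine hasWeakDeriv_of_hasDerivAt_off_countable (s := {a, b}) (Set.toFinite _).countable ?_ ?_
    ((h.integrable_indicator hF hg).1.sub hF.integrable_slope_comp.1).locallyIntegrable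
  · rw [extendZeroOne_eq_IccExtend h.lt.le h.left h.right]
    exact h.continuousOn_fst.domRestrict.Icc_extend'.sub hF.continuous
  intro x hx
  simp only [mem_insert_iff, mem_singleton_iff, not_or] at hx
  refine HasDerivAt.fun_sub ?_ (hF.hasDerivAt x)
  rcases lt_or_gt_of_ne hx.1 with h1 | h1
  · rw [indicator_of_notMem fun h => by linarith [h.1]]
    refine (hasDerivAt_const x (0 : ℝ)).congr_of_eventuallyEq ?_
    filter_upwards [Iio_mem_nhds h1] with y hy using extendZeroOne_of_lt hy
  rcases lt_or_gt_of_ne hx.2 with h2 | h2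
  · rw [indicator_of_mem (show x ∈ Ioo a b from ⟨h1, h2⟩)]
    refine (h.hasDerivAt_fst x ⟨h1, h2⟩).congr_of_eventuallyEq ?_
    filter_upwards [Ioo_mem_nhds h1 h2] with y hy using
      extendZeroOne_of_mem (Ioo_subset_Icc_self hy)
  · rw [indicator_of_notMem fun h => by linarith [h.2]]
    refine (hasDerivAt_const x (1 : ℝ)).congr_of_eventuallyEq ?_
    filter_upwards [Ioi_mem_nhds h2] with y hy using extendZeroOne_of_gt h.lt.le hy

theorem norms_le (h : IsProfile g lam a b p u v) (hF : IsFront g c Φ Ψ Q)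
    (hg : BistableLipschitz g K α) {η : ℝ} (hη : 0 ≤ η)
    (hclose : ∀ x, |extendZeroOne a b u x - Φ x| ≤ η ∧ |(Ioo a b).indicator v x - Q (Φ x)| ≤ η) :
    sobolevNormInfty (fun x => extendZeroOne a b u x - Φ x) +
      weakDerivNormTwo (fun x => extendZeroOne a b u x - Φ x) ≤
        ENNReal.ofReal (η + η + √(η * 2)) := by
  have hw := h.hasWeakDeriv_sub hF hg
  have hi := h.integrable_indicator hF hg
  have hQ := hF.integrable_slope_comp
  have h1 : sobolevNormInfty (fun x => extendZeroOne a b u x - Φ x) ≤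
      ENNReal.ofReal η + ENNReal.ofReal η := by
    -- One explicit weak derivative bounds the infimum from above, so its uniqueness plays no role.
    refine (iInf₂_le _ hw).trans (add_le_add ?_ ?_) <;> rw [eLpNorm_exponent_top]
    · exact eLpNormEssSup_le_of_ae_bound (Eventually.of_forall fun x => (hclose x).1)
    · exact eLpNormEssSup_le_of_ae_bound (Eventually.of_forall fun x => (hclose x).2)
  have h2 : weakDerivNormTwo (fun x => extendZeroOne a b u x - Φ x) ≤
      ENNReal.ofReal √(η * 2) := by
    refine (iInf₂_le _ hw).trans (eLpNorm_two_le_of_bound hη (fun x => (hclose x).2)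
      (hi.1.sub hQ.1) ?_)
    calc ∫ x, |(Ioo a b).indicator v x - Q (Φ x)|
        ≤ ∫ x, (|(Ioo a b).indicator v x| + Q (Φ x)) := by
          refine integral_mono (hi.1.sub hQ.1).abs (hi.1.abs.add hQ.1) fun x => ?_
          refine (abs_sub _ _).trans_eq ?_
          rw [abs_of_pos (hF.slope_pos _ (hF.mem_Ioo x))]
      _ = 2 := by rw [integral_add hi.1.abs hQ.1, hi.2, hQ.2]; norm_num
  refine (add_le_add h1 h2).trans_eq ?_
  rw [ENNReal.ofReal_add (by linarith) (Real.sqrt_nonneg _), ENNReal.ofReal_add hη hη]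

end IsProfile

theorem lemma4p12 (f : ℝ → ℝ) (hf : IsBistable f)
    (c : ℝ) (Φ : ℝ → ℝ) (hΦ : IsTravellingWave f c Φ) :
    (∀ ε : ℝ, 0 < ε → ∃ R : ℝ, ∀ (a b : ℝ) (u : ℝ → ℝ),
      IsStationarySolution f a b u → R < b - a → |nonlocalSpeed f a b u - c| < ε) ∧
    (Φ 0 = 1 / 2 → ∀ ε : ℝ, 0 < ε → ∃ R : ℝ, ∀ (a b : ℝ) (u : ℝ → ℝ),
      IsStationarySolution f a b u → R < b - a → (0 : ℝ) ∈ Ioo a b → u 0 = 1 / 2 →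
        sobolevNormInfty (fun x => extendZeroOne a b u x - Φ x) +
          weakDerivNormTwo (fun x => extendZeroOne a b u x - Φ x) < ENNReal.ofReal ε) := by
  obtain ⟨g, K, α, hg, he⟩ := hf.exists_lipschitz
  obtain ⟨Ψ, Q, hF⟩ := hΦ.exists_isFront hg he
  refine ⟨fun ε hε => ?_, fun hΦ0 ε hε => ?_⟩
  · have hα : 0 < α * (1 - α) := mul_pos hg.mem_Ioo.1 (by linarith [hg.mem_Ioo.2])
    obtain ⟨R, hR⟩ := hF.exists_length_slope_lt hg (mul_pos hε hα)
    refine ⟨R, fun a b u hu hlen => ?_⟩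
    obtain ⟨p, v, h⟩ := hu.exists_isProfile hg he
    rw [abs_sub_comm]
    refine (h.abs_speed_sub_le hF hg).1.trans_lt ?_
    rw [div_lt_iff₀ hα]
    exact hR _ a b p u v h hlen
  -- Then `η + η + √(η * 2) ≤ ε / 8 + ε / 8 + ε / 4 < ε`.
  · set η := min (ε / 8) (ε ^ 2 / 32)
    have hη : 0 < η := by positivity
    obtain ⟨R, hR⟩ := hF.exists_length_uniform_close hg hΦ0 hη
    refine ⟨R, fun a b u hu hlen h0 hu0 => ?_⟩
    obtain ⟨p, v, h⟩ := hu.exists_isProfile hg he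
    refine (h.norms_le hF hg hη.le (hR _ a b p u v h hlen h0 hu0)).trans_lt
      ((ENNReal.ofReal_lt_ofReal_iff hε).2 ?_)
    have h1 : η ≤ ε / 8 := min_le_left _ _
    have h2 : √(η * 2) ≤ ε / 4 := by
      refine Real.sqrt_le_iff.2 ⟨by linarith, ?_⟩
      have : η ≤ ε ^ 2 / 32 := min_le_right _ _
      nlinarith
    linarith
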